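/- Call a Borel set $B\subset\mathbb{R}$ \emph{measured} if there is a translation invariant Borel measure $\mu$ on $\mathbb{R}$ such that $\mu(B)>0$ and $B$ has $\sigma$-finite $\mu$-measure. A gauge function is a monotone increasing right continuous function $g:[0,\infty)\to[0,\infty)$, and $\mathcal{H}^g$ denotes the corresponding Hausdorff measure on $\mathbb{R}$, $$\mathcal{H}^g(A)=\lim_{\delta\to0+}\inf\Big\{\sum_{i}g(\operatorname{diam}U_i)\,:\,A\subset\bigcup_{i}U_i,\ \operatorname{diam}U_i<\delta\Big\},$$ the infimum being over countable covers by non-empty sets. A set $A\subset\mathbb{R}$ is \emph{measured by a Hausdorff measure} if for some gauge function $g$ we have $\mathcal{H}^g(A)>0$ and $A$ has $\sigma$-finite $\mathcal{H}^g$-measure. There is a compact set $K\subset\mathbb{R}$ which is measured, but is not a union of countably many sets each of which is measured by some Hausdorff measure (the gauge function may depend on the set). Moreover, $K$ can be chosen of the form $K=f(E)$, where $E\subset[0,1]$ is a non-empty compact set of box dimension $0$ which is not a union of countably many measured sets, $f:[0,1]\to\mathbb{R}$ is $C^1$ and bi-Lipschitz, and for a typical $h\in C^1([0,1])$ (that is,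 for all $h$ in a comeagre subset of $C^1([0,1])$ with the $C^1$ norm) the equation $x-y=u-v$ has only trivial solutions in $h(E)$: if $x,y,u,v\in h(E)$ and $x-y=u-v$, then $x=u$ and $y=v$, or $x=y$ and $u=v$. -/

import Mathlib

open Set Filter Topology MeasureTheory
open scoped NNReal ENNReal

noncomputable section

/-- `μ` assigns positive and `σ`-finite measure to `B`. -/
def GivesPosSigmaFinite (μ : Measure ℝ) (B : Set ℝ) : Prop :=
  0 < μ B ∧ SigmaFinite (μ.restrict B)

/-- A Borel set `B ⊆ ℝ` is measured if some translation invariant Borel measure (not required to be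
`σ`-finite or locally finite on `ℝ`) gives it positive and `σ`-finite measure. -/
def Measured (B : Set ℝ) : Prop :=
  MeasurableSet B ∧ ∃ μ : Measure ℝ, μ.IsAddLeftInvariant ∧ GivesPosSigmaFinite μ B

/-- Gauge functions: monotone increasing right continuous `g : [0, ∞) → [0, ∞)`. -/
def IsGauge (g : ℝ≥0 → ℝ≥0) : Prop :=
  Monotone g ∧ ∀ x, ContinuousWithinAt g (Ici x) x

/-- The Hausdorff measure with gauge function `g`: the limit as `δ → 0` of the infimum of
`∑ g (diam Uᵢ)` over countable covers by sets of diameter at most `δ`, see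
`MeasureTheory.Measure.mkMetric_apply`. Empty sets in a cover contribute `0`. The value of the size
function at infinite diameter is immaterial. -/
def gaugeHausdorff (g : ℝ≥0 → ℝ≥0) : Measure ℝ :=
  Measure.mkMetric fun d : ℝ≥0∞ => (g d.toNNReal : ℝ≥0∞)

/-- `A ⊆ ℝ` is measured by some Hausdorff measure. -/
def MeasuredByHausdorff (A : Set ℝ) : Prop :=
  ∃ g : ℝ≥0 → ℝ≥0, IsGauge g ∧ GivesPosSigmaFinite (gaugeHausdorff g) A

/-- `E` is the union of (at most) countably many sets with property `P`. -/
def IsCountableUnionOf (P : Set ℝ → Prop) (E : Set ℝ) : Prop :=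
  ∃ 𝒜 : Set (Set ℝ), 𝒜.Countable ∧ (∀ A ∈ 𝒜, P A) ∧ ⋃₀ 𝒜 = E

/-- The non-empty bounded set `E ⊆ ℝ` has box dimension `d`: `log N(δ) / log (1/δ) → d` as
`δ → 0+`, where `N(δ)` is the least number of closed intervals of radius `δ` covering `E`. -/
def HasBoxDimension (E : Set ℝ) (d : ℝ) : Prop :=
  E.Nonempty ∧ Bornology.IsBounded E ∧
    Tendsto (fun δ : ℝ≥0 =>
        Real.log ((Metric.externalCoveringNumber δ E).toNat : ℝ) / Real.log (1 / (δ : ℝ)))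
      (𝓝[>] 0) (𝓝 d)

/-- The space `C¹([0,1])`: a function `f` is stored as the pair `(f, f')` of continuous functions on
`[0,1]` (the derivative is one-sided at the endpoints, and is determined by `f`). The topology, as a
subspace of `C([0,1]) × C([0,1])`, is that of the `C¹` norm. -/
abbrev C1Unit : Type :=
  {p : C(Icc (0 : ℝ) 1, ℝ) × C(Icc (0 : ℝ) 1, ℝ) //
    ∀ x : Icc (0 : ℝ) 1,
      HasDerivWithinAt (IccExtend zero_le_one p.1) (p.2 x) (Icc (0 : ℝ) 1) (x : ℝ)}

/-- The image `f(E) = {f(x) : x ∈ E}` of a set `E ⊆ [0,1]` under `f ∈ C¹([0,1])`. -/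
def C1Unit.img (f : C1Unit) (E : Set ℝ) : Set ℝ :=
  f.1.1 '' {x : Icc (0 : ℝ) 1 | (x : ℝ) ∈ E}

/-- `f` is bi-Lipschitz on `[0,1]`. -/
def C1Unit.IsBiLipschitz (f : C1Unit) : Prop :=
  ∃ K L : ℝ≥0, LipschitzWith K f.1.1 ∧ AntilipschitzWith L f.1.1

/-- The equation `x - y = u - v` has only trivial solutions in `A`. -/
def OnlyTrivialDifferences (A : Set ℝ) : Prop :=
  ∀ x ∈ A, ∀ y ∈ A, ∀ u ∈ A, ∀ v ∈ A,
    x - y = u - v → (x = u ∧ y = v) ∨ (x = y ∧ u = v)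

end

/-!
The set `E` consists of the reals `1 / 2 + ∑ aₙ 2⁻ⁿ rₙ` whose integer digits satisfy
`∑ |aₙ| 2⁻ⁿ ≤ 1`, where the scales `rₙ = digitScale n` decrease so fast that digits are unique and
the box dimension is `0`. Adding digit sequences amounts to translating the reals, so measured sets
covering `E` yield probability measures `νₖ` on digit sequences with a remnant of translation
invariance. Let `P` be the law of a sum of independent small translates of the `νₖ`. Almost every
sequence, for `P` and all `νₖ`, has tails of a fixed fast decay; adding a sequence `w` of slower
decay moves the `P`-typical sequences off a `νₖ`-conull set, hence off the `k`-th set of the cover,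
for every `k`. But they are still digits of points of `E`.

For typical `h`, the second differences `h x - h y - h u + h v` of separated quadruples in `E` do
not vanish: the fourth power of `E` is null for the one-dimensional Hausdorff measure, so a generic
multiple of a function without such zeros removes those of `h`. If `K = f(E)` has only trivial
differences, distinct translates of `K` meet in at most one point, and the sum of all translates of
an atomless measure on `K` shows that `K` is measured. Hausdorff measures, on the other hand, are
translation invariant and change by at most a constant factor under a bi-Lipschitz map, so a cover
of `K` by sets measured by Hausdorff measures would give one of `E` by measured sets.
-/

/-! ### The weighted norm on integer sequences -/

/-- The tail `∑_{n ≥ m} |a n| / 2 ^ n` of the weighted `ℓ¹` norm of an integer sequence, with value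
`∞` where the series diverges. -/
noncomputable def weightedTail (m : ℕ) (a : ℕ → ℤ) : ℝ≥0∞ :=
  ∑' n, ‖a (n + m)‖ₑ / 2 ^ (n + m)

/-- The unit ball of the weighted `ℓ¹` norm on integer sequences. Its image under `digitReal` is the
set `E`. -/
def digitBall : Set (ℕ → ℤ) := {a | weightedTail 0 a ≤ 1}

lemma weightedTail_add_le (m : ℕ) (a b : ℕ → ℤ) :
    weightedTail m (a + b) ≤ weightedTail m a + weightedTail m b := by
  unfold weightedTail
  rw [← ENNReal.tsum_add]
  refine ENNReal.tsum_le_tsum fun n => ?_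
  rw [← ENNReal.add_div]
  gcongr
  exact enorm_add_le _ _

lemma weightedTail_sub_le (m : ℕ) (a b : ℕ → ℤ) :
    weightedTail m (a - b) ≤ weightedTail m a + weightedTail m b := by
  have hneg : weightedTail m (-b) = weightedTail m b := by simp [weightedTail]
  rw [sub_eq_add_neg, ← hneg]
  exact weightedTail_add_le m a (-b)

lemma enorm_div_le_weightedTail {m n : ℕ} (h : m ≤ n) (a : ℕ → ℤ) :
    ‖a n‖ₑ / 2 ^ n ≤ weightedTail m a := by
  obtain ⟨k, rfl⟩ := Nat.exists_eq_add_of_le' h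
  exact ENNReal.le_tsum (f := fun n => ‖a (n + m)‖ₑ / 2 ^ (n + m)) k

lemma weightedTail_eq_add_succ (m : ℕ) (a : ℕ → ℤ) :
    weightedTail m a = ‖a m‖ₑ / 2 ^ m + weightedTail (m + 1) a := by
  unfold weightedTail
  rw [tsum_eq_zero_add' ENNReal.summable, zero_add]
  simp only [add_assoc, add_comm 1 m]

lemma weightedTail_antitone (a : ℕ → ℤ) : Antitone fun m => weightedTail m a :=
  antitone_nat_of_succ_le fun m => by
    rw [weightedTail_eq_add_succ m]
    exact le_add_self

lemma weightedTail_zero_of_forall_lt_eq_zero {m : ℕ} {a : ℕ → ℤ} (h : ∀ i < m, a i = 0) :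
    weightedTail 0 a = weightedTail m a := by
  induction m with
  | zero => rfl
  | succ m ih =>
    rw [ih fun i hi => h i (by omega), weightedTail_eq_add_succ m, h m (by omega)]
    simp

lemma weightedTail_congr {m : ℕ} {a b : ℕ → ℤ} (h : ∀ i ≥ m, a i = b i) :
    weightedTail m a = weightedTail m b :=
  tsum_congr fun n => by rw [h _ (Nat.le_add_left m n)]

lemma eq_zero_of_weightedTail_zero_lt {k n : ℕ} (h : n ≤ k) {a : ℕ → ℤ}
    (ha : weightedTail 0 a < (1 / 2) ^ k) : a n = 0 := by
  by_contra h0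
  have h1 : (1 : ℝ≥0∞) ≤ ‖a n‖ₑ := by
    rw [← enorm_one (G := ℤ), enorm_le_iff_norm_le, norm_one, Int.norm_eq_abs]
    exact_mod_cast Int.one_le_abs h0
  refine ha.not_ge ?_
  calc (1 / 2 : ℝ≥0∞) ^ k ≤ (1 / 2) ^ n := pow_le_pow_right_of_le_one' (by norm_num) h
    _ = 1 / 2 ^ n := by rw [one_div, one_div, ENNReal.inv_pow]
    _ ≤ ‖a n‖ₑ / 2 ^ n := by gcongr
    _ ≤ weightedTail 0 a := enorm_div_le_weightedTail n.zero_le a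

lemma measurable_weightedTail (m : ℕ) : Measurable (weightedTail m) :=
  Measurable.tsum fun _ => ((measurable_pi_apply _).enorm).div_const _

lemma tendsto_weightedTail {a : ℕ → ℤ} (h : weightedTail 0 a ≠ ∞) :
    Tendsto (fun m => weightedTail m a) atTop (𝓝 0) :=
  ENNReal.tendsto_sum_nat_add (fun n => ‖a n‖ₑ / 2 ^ n) h

lemma tsum_one_half_pow_add_two : ∑' i : ℕ, (1 / 2 : ℝ≥0∞) ^ (i + 2) = 1 / 2 := by
  simp only [pow_add]
  rw [ENNReal.tsum_mul_right, one_div, ENNReal.tsum_geometric, ENNReal.one_sub_inv_two, inv_inv,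
    pow_two, ← mul_assoc, ENNReal.mul_inv_cancel (by simp) (by simp), one_mul]

lemma tendsto_measure_lt_weightedTail (ν : Measure (ℕ → ℤ)) [IsFiniteMeasure ν]
    (hν : ∀ᵐ a ∂ν, weightedTail 0 a ≠ ∞) {c : ℝ≥0∞} (hc : 0 < c) :
    Tendsto (fun m => ν {a | c < weightedTail m a}) atTop (𝓝 0) := by
  have hlim := tendsto_measure_iInter_atTop (μ := ν) (s := fun m => {a | c < weightedTail m a})
    (fun m => (measurableSet_lt measurable_const (measurable_weightedTail m)).nullMeasurableSet)
    (fun m n hmn a ha => lt_of_lt_of_le ha (weightedTail_antitone a hmn))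
    ⟨0, measure_ne_top _ _⟩
  have hnull : ν (⋂ m, {a | c < weightedTail m a}) = 0 := by
    refine measure_eq_zero_iff_ae_notMem.2 (hν.mono fun a h ha => ?_)
    obtain ⟨m, hm⟩ := ((tendsto_weightedTail h).eventually_lt_const hc).exists
    exact lt_asymm hm (mem_iInter.1 ha m)
  rwa [hnull] at hlim

lemma exists_tail_rate (ν : Measure (ℕ → ℤ)) [SFinite ν] (hν : ∀ᵐ a ∂ν, weightedTail 0 a ≠ ∞)
    {ε : ℕ → ℝ≥0∞} (hε : ∀ i, 0 < ε i) (N : ℕ → ℕ) :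
    ∃ M : ℕ → ℕ, StrictMono M ∧ (∀ i, N i ≤ M i) ∧
      ∀ᵐ a ∂ν, ∀ᶠ i in atTop, weightedTail (M i) a ≤ ε i := by
  have hfin : ∀ᵐ a ∂ν.toFinite, weightedTail 0 a ≠ ∞ :=
    (toFinite_absolutelyContinuous ν).ae_le hν
  have hsmall : ∀ i, ∀ᶠ m in atTop, N i ≤ m ∧
      ν.toFinite {a | ε i < weightedTail m a} < (1 / 2) ^ i := fun i =>
    (eventually_ge_atTop _).and <| (tendsto_measure_lt_weightedTail _ hfin
      (hε i)).eventually_lt_const (ENNReal.pow_pos (by norm_num) _)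
  obtain ⟨M, hM, hM'⟩ := extraction_forall_of_eventually hsmall
  refine ⟨M, hM, fun i => (hM' i).1, ?_⟩
  have hsum : ∑' i, ν.toFinite {a | ε i < weightedTail (M i) a} ≠ ∞ :=
    ne_top_of_le_ne_top (b := ∑' i, (1 / 2 : ℝ≥0∞) ^ i) (by simp [ENNReal.tsum_geometric])
      (ENNReal.tsum_le_tsum fun i => (hM' i).2.le)
  filter_upwards [(absolutelyContinuous_toFinite ν).ae_le (ae_eventually_notMem hsum)] with a ha
  simpa using ha

/-- The integer sequence with entry `2 ^ (M i - (i + 2))` at the place `M i`, so that this place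
contributes `(1 / 2) ^ (i + 2)` to the weighted norm. Its tails beyond `M i` decay more slowly than
those of the sequences in a given set of full measure, if `M` grows fast enough. -/
noncomputable def slowSeq (M : ℕ → ℕ) : ℕ → ℤ :=
  Function.extend M (fun i => 2 ^ (M i - (i + 2))) 0

lemma enorm_slowSeq_div {M : ℕ → ℕ} (hM : StrictMono M) (hM' : ∀ i, i + 2 ≤ M i) (i : ℕ) :
    ‖slowSeq M (M i)‖ₑ / 2 ^ M i = (1 / 2) ^ (i + 2) := by
  obtain ⟨k, hk⟩ := Nat.exists_eq_add_of_le' (hM' i)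
  have h2 : ‖(2 : ℤ)‖ₑ = 2 := by
    rw [← ofReal_norm, Int.norm_eq_abs]; simp
  rw [slowSeq, hM.injective.extend_apply, enorm_pow, h2, hk, Nat.add_sub_cancel, pow_add 2 k,
    one_div, ← ENNReal.inv_pow, ← one_div,
    ← ENNReal.mul_div_mul_left 1 (2 ^ (i + 2)) (c := 2 ^ k) (by simp) (by simp), mul_one]

lemma weightedTail_slowSeq {M : ℕ → ℕ} (hM : StrictMono M) (hM' : ∀ i, i + 2 ≤ M i) :
    weightedTail 0 (slowSeq M) = 1 / 2 := by
  have hterm : ∀ n, ‖slowSeq M (n + 0)‖ₑ / 2 ^ (n + 0) =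
      Function.extend M (fun i => (1 / 2) ^ (i + 2)) 0 n := by
    intro n
    by_cases h : ∃ i, M i = n
    · obtain ⟨i, rfl⟩ := h
      rw [hM.injective.extend_apply, add_zero, enorm_slowSeq_div hM hM']
    · rw [Function.extend_apply' _ _ _ h]
      simp [slowSeq, Function.extend_apply' _ _ _ h]
  rw [weightedTail, tsum_congr hterm, tsum_extend_zero hM.injective, tsum_one_half_pow_add_two]

/-- The translate by a sequence of slow decay leaves the set of sequences of fast decay. -/
lemma exists_conull_disjoint_translate (ν : Measure (ℕ → ℤ)) [SFinite ν]
    (hν : ∀ᵐ a ∂ν, weightedTail 0 a ≠ ∞) :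
    ∃ C, MeasurableSet C ∧ (∀ᵐ a ∂ν, a ∈ C) ∧
      ∃ w, weightedTail 0 w ≤ 1 / 2 ∧ ∀ a ∈ C, a + w ∉ C := by
  obtain ⟨M, hM, hM', hrate⟩ := exists_tail_rate ν hν (ε := fun i => (1 / 2) ^ (i + 4))
    (fun i => ENNReal.pow_pos (by norm_num) _) (fun i => i + 2)
  obtain ⟨C, hC, hCmeas, hrateC⟩ := hrate.exists_measurable_mem
  refine ⟨C, hCmeas, hC, slowSeq M, (weightedTail_slowSeq hM hM').le, fun a ha haw => ?_⟩
  obtain ⟨i, hi, hiw⟩ := ((hrateC a ha).and (hrateC _ haw)).exists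
  refine (ENNReal.half_lt_self (a := (1 / 2) ^ (i + 2)) (by simp) (by simp)).not_ge ?_
  calc (1 / 2 : ℝ≥0∞) ^ (i + 2) = ‖slowSeq M (M i)‖ₑ / 2 ^ M i :=
        (enorm_slowSeq_div hM hM' i).symm
    _ ≤ weightedTail (M i) (slowSeq M) := enorm_div_le_weightedTail le_rfl _
    _ = weightedTail (M i) (a + slowSeq M - a) := by rw [add_sub_cancel_left]
    _ ≤ weightedTail (M i) (a + slowSeq M) + weightedTail (M i) a := weightedTail_sub_le _ _ _
    _ ≤ (1 / 2) ^ (i + 4) + (1 / 2) ^ (i + 4) := add_le_add hiw hi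
    _ = (1 / 2) ^ (i + 2) / 2 := by
      simp only [pow_add _ i, div_eq_mul_inv, one_mul, ← mul_add, mul_assoc]
      congr 1
      rw [pow_succ _ 3, ← mul_two, mul_assoc, ENNReal.inv_mul_cancel] <;> simp [pow_succ, mul_assoc]

/-! ### Sums of independent translates -/

lemma exists_finsupp_weightedTail_sub_lt {a : ℕ → ℤ} (ha : weightedTail 0 a ≠ ∞) {η : ℝ≥0∞}
    (hη : 0 < η) : ∃ c : ℕ →₀ ℤ, weightedTail 0 (a - ⇑c) < η := by
  obtain ⟨m, hm⟩ := ((tendsto_weightedTail ha).eventually_lt_const hη).exists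
  refine ⟨Finsupp.onFinset (Finset.range m) (fun n => if n < m then a n else 0)
    (by simp +contextual), ?_⟩
  rw [weightedTail_zero_of_forall_lt_eq_zero (m := m) fun i hi => by simp [hi],
    weightedTail_congr (b := a) fun i hi => by simp [not_lt.2 hi]]
  exact hm

lemma exists_small_translate (ν : Measure (ℕ → ℤ)) [IsProbabilityMeasure ν]
    (hν : ∀ᵐ a ∂ν, weightedTail 0 a ≠ ∞) {η : ℝ≥0∞} (hη : 0 < η) :
    ∃ (c : ℕ → ℤ) (ν' : Measure (ℕ → ℤ)), IsProbabilityMeasure ν' ∧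
      (∀ᵐ y ∂ν', weightedTail 0 y < η) ∧ ν' ≪ ν.map (· - c) := by
  let A : (ℕ →₀ ℤ) → Set (ℕ → ℤ) := fun c => {a | weightedTail 0 (a - ⇑c) < η}
  have hA : ν (⋃ c, A c) ≠ 0 := fun h0 => by
    obtain ⟨a, ha, haA⟩ := (hν.and (measure_eq_zero_iff_ae_notMem.1 h0)).exists
    exact haA (mem_iUnion.2 (exists_finsupp_weightedTail_sub_lt ha hη))
  obtain ⟨c, hc⟩ := exists_measure_pos_of_not_measure_iUnion_null hA
  have hsub : Measurable fun a : ℕ → ℤ => a - ⇑c := by fun_prop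
  have hlt : MeasurableSet {y : ℕ → ℤ | weightedTail 0 y < η} :=
    measurableSet_lt (measurable_weightedTail 0) measurable_const
  have := ProbabilityTheory.cond_isProbabilityMeasure hc.ne'
  refine ⟨c, (ProbabilityTheory.cond ν (A c)).map (· - ⇑c),
    Measure.isProbabilityMeasure_map hsub.aemeasurable, ?_,
    ProbabilityTheory.cond_absolutelyContinuous.map hsub⟩
  rw [ae_map_iff hsub.aemeasurable hlt]
  exact ProbabilityTheory.ae_cond_mem (hsub hlt)

section InfinitePi

variable {ι : Type*} [DecidableEq ι] {X : ι → Type*} [∀ i, MeasurableSpace (X i)]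

lemma measurable_uncurry_update (k : ι) :
    Measurable fun p : (∀ i, X i) × X k => Function.update p.1 k p.2 := by
  refine measurable_pi_iff.2 fun i => ?_
  obtain rfl | h := eq_or_ne i k
  · simpa only [Function.update_self] using measurable_snd
  · simp only [Function.update_of_ne h]
    fun_prop

lemma infinitePi_map_update (μ : ∀ i, Measure (X i)) [∀ i, IsProbabilityMeasure (μ i)] (k : ι) :
    ((Measure.infinitePi μ).prod (μ k)).map (fun p => Function.update p.1 k p.2) =
      Measure.infinitePi μ := by
  refine Measure.eq_infinitePi μ fun s t ht => ?_
  rw [Measure.map_apply (measurable_uncurry_update k)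
    (MeasurableSet.pi s.countable_toSet fun i _ => ht i)]
  by_cases hk : k ∈ s
  · have hpre : (fun p : (∀ i, X i) × X k => Function.update p.1 k p.2) ⁻¹' (s : Set ι).pi t =
        ((s.erase k : Finset ι) : Set ι).pi t ×ˢ t k := by
      ext ⟨ω, y⟩
      simp only [mem_preimage, update_mem_pi_iff]
      simp [hk]
    rw [hpre, Measure.prod_prod, Measure.infinitePi_pi μ fun i _ => ht i, mul_comm,
      Finset.mul_prod_erase s (fun i => μ i (t i)) hk]
  · have hpre : (fun p : (∀ i, X i) × X k => Function.update p.1 k p.2) ⁻¹' (s : Set ι).pi t =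
        (s : Set ι).pi t ×ˢ univ := by
      ext ⟨ω, y⟩
      simp only [mem_preimage, update_mem_pi_iff]
      simp [hk]
    rw [hpre, Measure.prod_prod, Measure.infinitePi_pi μ fun i _ => ht i, measure_univ, mul_one]

end InfinitePi

/-- The sum `∑ k, ω k` of a sequence of integer sequences the `k`-th of which vanishes at all places
before `k`, so that only finitely many of them contribute to each place. -/
def diagSum (ω : ℕ → ℕ → ℤ) : ℕ → ℤ := fun n => ∑ k ∈ Finset.range (n + 1), ω k n

lemma measurable_diagSum : Measurable diagSum :=
  measurable_pi_iff.2 fun n => by unfold diagSum; fun_prop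

lemma weightedTail_diagSum_le (ω : ℕ → ℕ → ℤ) :
    weightedTail 0 (diagSum ω) ≤ ∑' k, weightedTail 0 (ω k) := by
  unfold weightedTail
  rw [ENNReal.tsum_comm]
  refine ENNReal.tsum_le_tsum fun n => ?_
  calc ‖diagSum ω n‖ₑ / 2 ^ n ≤ (∑ k ∈ Finset.range (n + 1), ‖ω k n‖ₑ) / 2 ^ n := by
        gcongr
        exact enorm_sum_le _ _
    _ = ∑ k ∈ Finset.range (n + 1), ‖ω k n‖ₑ / 2 ^ n := by
        simp only [div_eq_mul_inv, Finset.sum_mul]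
    _ ≤ ∑' k, ‖ω k n‖ₑ / 2 ^ n := ENNReal.sum_le_tsum _

lemma diagSum_update (ω : ℕ → ℕ → ℤ) {k : ℕ} {y : ℕ → ℤ} (hy : ∀ n < k, y n = 0) :
    diagSum (Function.update ω k y) = y + diagSum (Function.update ω k 0) := by
  ext n
  have hoff : ∀ z : ℕ → ℤ, ∑ i ∈ (Finset.range (n + 1)).erase k, Function.update ω k z i n =
      ∑ i ∈ (Finset.range (n + 1)).erase k, ω i n := fun z =>
    Finset.sum_congr rfl fun i hi => by rw [Function.update_of_ne (Finset.ne_of_mem_erase hi)]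
  by_cases hk : k ∈ Finset.range (n + 1)
  · simp only [diagSum, Pi.add_apply, ← Finset.add_sum_erase _ _ hk, hoff, Function.update_self,
      Pi.zero_apply, zero_add]
  · simp only [diagSum, Pi.add_apply, hy n (by simpa using hk), zero_add]
    rw [← Finset.erase_eq_of_notMem hk, hoff, hoff]

/-- Fubini's theorem in the `k`-th coordinate: given the other coordinates, `diagSum ω` is a
translate of `ω k`. -/
lemma infinitePi_diagSum_add_preimage_eq_zero (ν : ℕ → Measure (ℕ → ℤ))
    [∀ k, IsProbabilityMeasure (ν k)] {k : ℕ} (hk : ∀ᵐ y ∂ν k, ∀ n < k, y n = 0) {N : Set (ℕ → ℤ)}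
    (hN : MeasurableSet N) (hνN : ∀ w, ν k ((· + w) ⁻¹' N) = 0) (w : ℕ → ℤ) :
    Measure.infinitePi ν ((diagSum · + w) ⁻¹' N) = 0 := by
  have hmeas : MeasurableSet ((diagSum · + w) ⁻¹' N) := (measurable_diagSum.add_const w) hN
  have hup := measurable_uncurry_update (X := fun _ : ℕ => ℕ → ℤ) k
  rw [← infinitePi_map_update ν k, Measure.map_apply hup hmeas,
    Measure.measure_prod_null (hup hmeas)]
  refine Eventually.of_forall fun ω => measure_eq_zero_iff_ae_notMem.2 ?_
  filter_upwards [hk, measure_eq_zero_iff_ae_notMem.1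
    (hνN (diagSum (Function.update ω k 0) + w))] with y hy hyN
  simpa only [mem_preimage, diagSum_update ω hy, add_assoc] using hyN

/-- The law of a sum of independent small translates of the `ν k`. -/
lemma exists_measure_forall_translate_null (ν : ℕ → Measure (ℕ → ℤ))
    [∀ k, IsProbabilityMeasure (ν k)] (hν : ∀ k, ∀ᵐ a ∂ν k, weightedTail 0 a ≠ ∞) :
    ∃ P : Measure (ℕ → ℤ), IsProbabilityMeasure P ∧ (∀ᵐ a ∂P, weightedTail 0 a ≤ 1 / 2) ∧
      ∀ k N, MeasurableSet N → (∀ w, ν k ((· + w) ⁻¹' N) = 0) → ∀ w, P ((· + w) ⁻¹' N) = 0 := by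
  choose c ν' hprob hsmall hac using fun k =>
    exists_small_translate (ν k) (hν k) (η := (1 / 2) ^ (k + 2)) (ENNReal.pow_pos (by norm_num) _)
  refine ⟨(Measure.infinitePi ν').map diagSum,
    Measure.isProbabilityMeasure_map measurable_diagSum.aemeasurable, ?_, fun k N hN hνN w => ?_⟩
  · rw [ae_map_iff measurable_diagSum.aemeasurable
      (measurableSet_le (measurable_weightedTail 0) measurable_const)]
    have hall : ∀ᵐ ω ∂Measure.infinitePi ν', ∀ k, weightedTail 0 (ω k) < (1 / 2) ^ (k + 2) :=
      ae_all_iff.2 fun k =>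
        (measurePreserving_eval_infinitePi ν' k).quasiMeasurePreserving.ae (hsmall k)
    filter_upwards [hall] with ω hω
    calc weightedTail 0 (diagSum ω) ≤ ∑' k, weightedTail 0 (ω k) := weightedTail_diagSum_le ω
      _ ≤ ∑' k : ℕ, (1 / 2) ^ (k + 2) := ENNReal.tsum_le_tsum fun k => (hω k).le
      _ = 1 / 2 := tsum_one_half_pow_add_two
  · have hzero : ∀ᵐ y ∂ν' k, ∀ n < k, y n = 0 := (hsmall k).mono fun y hy n hn =>
      eq_zero_of_weightedTail_zero_lt (by omega : n ≤ k + 2) hy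
    have hnull : ∀ u, ν' k ((· + u) ⁻¹' N) = 0 := fun u => hac k <| by
      rw [Measure.map_apply (measurable_sub_const _) (measurable_add_const u hN)]
      convert hνN (u - c k) using 2
      ext a
      simp only [mem_preimage, sub_add_eq_add_sub, add_sub_assoc]
    rw [Measure.map_apply measurable_diagSum (measurable_add_const w hN)]
    exact infinitePi_diagSum_add_preimage_eq_zero ν' hzero hN hnull w

/-- Every translate of a `ν`-null measurable subset of `B` is `ν`-null. For `ν` a finite measure
with the null sets of the restriction to `B` of a translation invariant measure, this is what is
left of the invariance. -/
def IsAddQuasiInvariantOn {G : Type*} [Add G] [MeasurableSpace G] (ν : Measure G) (B : Set G) :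
    Prop :=
  ∀ N, MeasurableSet N → N ⊆ B → ν N = 0 → ∀ w, ν ((· + w) ⁻¹' N) = 0

theorem not_digitBall_subset_iUnion (B : ℕ → Set (ℕ → ℤ)) (hB : ∀ k, MeasurableSet (B k))
    (ν : ℕ → Measure (ℕ → ℤ)) [∀ k, IsProbabilityMeasure (ν k)]
    (hν : ∀ k, ∀ᵐ a ∂ν k, a ∈ digitBall) (hinv : ∀ k, IsAddQuasiInvariantOn (ν k) (B k)) :
    ¬ digitBall ⊆ ⋃ k, B k := by
  intro hcov
  have hfin : ∀ k, ∀ᵐ a ∂ν k, weightedTail 0 a ≠ ∞ := fun k =>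
    (hν k).mono fun a ha => ne_top_of_le_ne_top ENNReal.one_ne_top ha
  obtain ⟨P, hP, hPle, hPnull⟩ := exists_measure_forall_translate_null ν hfin
  obtain ⟨C, hC, hCae, w, hw, hCw⟩ := exists_conull_disjoint_translate (Measure.sum ν + P) <|
    ae_add_measure_iff.2 ⟨(Measure.ae_sum_iff).2 hfin,
      hPle.mono fun a ha => ne_top_of_le_ne_top (by simp) ha⟩
  rw [ae_add_measure_iff] at hCae
  have hdiff : ∀ k, P ((· + w) ⁻¹' (B k \ C)) = 0 := fun k =>
    hPnull k _ ((hB k).diff hC) (hinv k _ ((hB k).diff hC) sdiff_subset <|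
      measure_mono_null (fun a ha => ha.2) (Measure.ae_sum_iff |>.1 hCae.1 k)) w
  obtain ⟨a, hle, haC, haB⟩ := (hPle.and (hCae.2.and
    (ae_all_iff.2 fun k => measure_eq_zero_iff_ae_notMem.1 (hdiff k)))).exists
  have hball : a + w ∈ digitBall :=
    (weightedTail_add_le 0 a w).trans ((add_le_add hle hw).trans (ENNReal.add_halves 1).le)
  obtain ⟨k, hk⟩ := mem_iUnion.1 (hcov hball)
  exact haB k ⟨hk, hCw a haC⟩

/-! ### The digit set -/

/-- Rapidly decreasing scales: the digit at the place `n` of an expansion has weight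
`digitScale n / 2 ^ n`. -/
noncomputable def digitScale (n : ℕ) : ℝ≥0 := (1 / 2) ^ (n + 1) ^ 3

/-- The sum of the expansion with integer digits `a`, junk unless `a` has finite weighted norm. -/
noncomputable def digitSum (a : ℕ → ℤ) : ℝ := ∑' n, a n / 2 ^ n * digitScale n

/-- The real number with the integer digits `a`, shifted so that sequences in `digitBall` represent
numbers in `[0,1]`. -/
noncomputable def digitReal (a : ℕ → ℤ) : ℝ := 1 / 2 + digitSum a

/-- The set of the reals whose digit sequences lie in `digitBall`. -/
def digitSet : Set ℝ := digitReal '' digitBall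

lemma digitScale_pos (n : ℕ) : 0 < digitScale n := by unfold digitScale; positivity

lemma digitScale_antitone : Antitone digitScale := fun m n h =>
  pow_le_pow_of_le_one (by simp) (by norm_num [← NNReal.coe_le_coe]) (by gcongr)

lemma two_mul_digitScale_succ_lt (n : ℕ) : 2 * digitScale (n + 1) < digitScale n / 2 ^ n := by
  have hexp : (n + 2) ^ 3 = (n + 1) ^ 3 + (n + 1) + (3 * n ^ 2 + 8 * n + 6) := by ring
  have hhalf : (1 / 2 : ℝ≥0) ^ (3 * n ^ 2 + 8 * n + 6) < 1 :=
    pow_lt_one₀ (by simp) (by norm_num [← NNReal.coe_lt_coe]) (by positivity)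
  calc 2 * digitScale (n + 1)
      = digitScale n / 2 ^ n * (1 / 2) ^ (3 * n ^ 2 + 8 * n + 6) := by
        rw [digitScale, digitScale, show n + 1 + 1 = n + 2 from rfl, hexp, pow_add, pow_add,
          pow_succ (1 / 2) n]
        simp only [one_div, inv_pow]
        field_simp
    _ < digitScale n / 2 ^ n :=
        mul_lt_of_lt_one_right (div_pos (digitScale_pos n) (by positivity)) hhalf

lemma summable_digitScale : Summable digitScale := by
  refine NNReal.summable_of_le (fun n => ?_) (NNReal.summable_geometric (r := 1 / 2) ?_)
  · refine pow_le_pow_of_le_one (by simp) (by norm_num [← NNReal.coe_le_coe]) ?_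
    exact n.le_succ.trans (Nat.le_self_pow (by norm_num) (n + 1))
  · norm_num [← NNReal.coe_lt_coe]

lemma hasSum_abs_div_two_pow {a : ℕ → ℤ} (ha : weightedTail 0 a ≠ ∞) :
    HasSum (fun n => |(a n : ℝ)| / 2 ^ n) (weightedTail 0 a).toReal := by
  rw [weightedTail, ENNReal.tsum_toReal_eq (ENNReal.ne_top_of_tsum_ne_top ha)]
  simpa [Int.norm_eq_abs] using ENNReal.hasSum_toReal ha

lemma abs_digit_term_le {a : ℕ → ℤ} {n : ℕ} (hn : ∀ i < n, a i = 0) (k : ℕ) :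
    ‖(a k : ℝ) / 2 ^ k * digitScale k‖ ≤ digitScale n * (|(a k : ℝ)| / 2 ^ k) := by
  rw [norm_mul, norm_div, norm_pow, Real.norm_two, Real.norm_eq_abs, NNReal.norm_eq, mul_comm]
  obtain hk | hk := lt_or_ge k n
  · simp [hn k hk]
  · gcongr
    exact digitScale_antitone hk

lemma summable_digits {a : ℕ → ℤ} (ha : weightedTail 0 a ≠ ∞) :
    Summable fun n => (a n : ℝ) / 2 ^ n * digitScale n :=
  .of_norm_bounded ((hasSum_abs_div_two_pow ha).summable.mul_left _)
    (abs_digit_term_le (n := 0) (by simp))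

lemma abs_digitSum_le {a : ℕ → ℤ} {c : ℝ≥0} (ha : weightedTail 0 a ≤ c) {n : ℕ}
    (hn : ∀ i < n, a i = 0) : |digitSum a| ≤ digitScale n * c := by
  refine (tsum_of_norm_bounded ((hasSum_abs_div_two_pow (ne_top_of_le_ne_top
    ENNReal.coe_ne_top ha)).mul_left _) (abs_digit_term_le hn)).trans ?_
  gcongr
  exact ENNReal.toReal_le_coe_of_le_coe ha

lemma digitSum_sub {a b : ℕ → ℤ} (ha : weightedTail 0 a ≠ ∞) (hb : weightedTail 0 b ≠ ∞) :
    digitSum (a - b) = digitSum a - digitSum b := by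
  rw [digitSum, digitSum, digitSum, ← (summable_digits ha).tsum_sub (summable_digits hb)]
  exact tsum_congr fun n => by simp [sub_div, sub_mul]

lemma digitSum_single (n : ℕ) (z : ℤ) : digitSum (Pi.single n z) = z / 2 ^ n * digitScale n := by
  rw [digitSum, tsum_eq_single n fun k hk => by simp [hk], Pi.single_eq_same]

lemma digitSum_ne_zero {a : ℕ → ℤ} (ha : weightedTail 0 a ≤ 2) (ha0 : a ≠ 0) :
    digitSum a ≠ 0 := by
  classical
  have hex : ∃ n, a n ≠ 0 := Function.ne_iff.1 ha0
  obtain ⟨n, hn, hlt⟩ : ∃ n, a n ≠ 0 ∧ ∀ i < n, a i = 0 :=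
    ⟨Nat.find hex, Nat.find_spec hex, fun i hi => not_not.1 (Nat.find_min hex hi)⟩
  have hrest : ∀ i < n + 1, (a - Pi.single n (a n) : ℕ → ℤ) i = 0 := fun i hi => by
    obtain rfl | h := eq_or_ne i n
    · simp
    · simp [h, hlt i (by omega)]
  have htail : weightedTail 0 (a - Pi.single n (a n)) ≤ 2 := by
    rw [weightedTail_zero_of_forall_lt_eq_zero hrest,
      weightedTail_congr (b := a) fun i hi => by simp [show i ≠ n by omega]]
    exact (weightedTail_antitone a (Nat.zero_le _)).trans ha
  have hsmall : |digitSum (a - Pi.single n (a n))| ≤ digitScale (n + 1) * 2 :=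
    abs_digitSum_le (c := 2) htail hrest
  have hlead : (digitScale n : ℝ) / 2 ^ n ≤ |digitSum (Pi.single n (a n))| := by
    rw [digitSum_single, div_mul_eq_mul_div, abs_div, abs_mul, abs_of_pos (a := (2 : ℝ) ^ n)
      (by positivity), NNReal.abs_eq]
    gcongr
    refine le_mul_of_one_le_left (by positivity) ?_
    exact_mod_cast Int.one_le_abs hn
  have hscale : 2 * (digitScale (n + 1) : ℝ) < digitScale n / 2 ^ n := by
    exact_mod_cast two_mul_digitScale_succ_lt n
  intro h0
  have hsub := digitSum_sub (ne_top_of_le_ne_top (by simp) ha)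
    (ne_top_of_le_ne_top (by simp) htail)
  rw [sub_sub_cancel, h0, zero_sub] at hsub
  rw [hsub, abs_neg] at hlead
  linarith

lemma weightedTail_ne_top_of_mem_digitBall {a : ℕ → ℤ} (ha : a ∈ digitBall) :
    weightedTail 0 a ≠ ∞ := ne_top_of_le_ne_top ENNReal.one_ne_top ha

lemma digitReal_injOn : InjOn digitReal digitBall := fun a ha b hb hab => by
  by_contra hne
  refine digitSum_ne_zero (a := a - b) ?_ (sub_ne_zero.2 hne) ?_
  · exact (weightedTail_sub_le 0 a b).trans ((add_le_add ha hb).trans one_add_one_eq_two.le)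
  · rw [digitSum_sub (weightedTail_ne_top_of_mem_digitBall ha)
      (weightedTail_ne_top_of_mem_digitBall hb), sub_eq_zero]
    exact add_left_cancel hab

lemma abs_le_of_mem_digitBall {a : ℕ → ℤ} (ha : a ∈ digitBall) (n : ℕ) : |a n| ≤ 2 ^ n := by
  have h := (enorm_div_le_weightedTail n.zero_le a).trans ha
  rw [ENNReal.div_le_iff (by simp) (by simp), one_mul, ← ofReal_norm, Int.norm_eq_abs] at h
  have h' := ENNReal.toReal_mono (by simp) h
  rw [ENNReal.toReal_ofReal (abs_nonneg _)] at h'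
  exact_mod_cast h'

lemma lowerSemicontinuous_weightedTail (m : ℕ) : LowerSemicontinuous (weightedTail m) := by
  unfold weightedTail
  refine lowerSemicontinuous_tsum fun n => Continuous.lowerSemicontinuous ?_
  exact (ENNReal.continuous_div_const _ (by simp)).comp (by fun_prop)

lemma isClosed_digitBall : IsClosed digitBall :=
  (lowerSemicontinuous_weightedTail 0).isClosed_preimage 1

lemma isCompact_digitBall : IsCompact digitBall :=
  (isCompact_univ_pi (s := fun n : ℕ => Icc (-2 ^ n : ℤ) (2 ^ n))
    fun _ => (Set.finite_Icc _ _).isCompact).of_isClosed_subset isClosed_digitBall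
    fun _ ha n _ => abs_le.1 (abs_le_of_mem_digitBall ha n)

lemma continuousOn_digitReal : ContinuousOn digitReal digitBall := by
  refine continuousOn_const.add (continuousOn_tsum (u := fun n => (digitScale n : ℝ))
    (fun n => ?_) (by exact_mod_cast summable_digitScale) fun n a ha => ?_)
  · have : Continuous fun a : ℕ → ℤ => (a n : ℝ) :=
      continuous_of_discreteTopology.comp (continuous_apply n)
    exact ((this.div_const _).mul_const _).continuousOn
  · rw [norm_mul, norm_div, norm_pow, Real.norm_two, Real.norm_eq_abs, NNReal.norm_eq]
    refine mul_le_of_le_one_left (by positivity) ((div_le_one (by positivity)).2 ?_)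
    exact_mod_cast abs_le_of_mem_digitBall ha n

lemma isCompact_digitSet : IsCompact digitSet :=
  isCompact_digitBall.image_of_continuousOn continuousOn_digitReal

lemma digitSet_subset_Icc : digitSet ⊆ Icc 0 1 := by
  rintro _ ⟨a, ha, rfl⟩
  have h := abs_le.1 (abs_digitSum_le (c := 1) (n := 0) ha (by simp))
  norm_num [digitScale] at h
  unfold digitReal
  constructor <;> linarith

lemma digitSet_nonempty : digitSet.Nonempty :=
  ⟨digitReal 0, 0, by simp [digitBall, weightedTail], rfl⟩

lemma measurable_digitReal : Measurable digitReal := by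
  refine (Measurable.tsum fun n => ?_).const_add _
  exact (((measurable_of_countable fun z : ℤ => (z : ℝ)).comp (measurable_pi_apply n)).div_const
    _).mul_const _

lemma digitReal_add {a w : ℕ → ℤ} (ha : a ∈ digitBall) (haw : a + w ∈ digitBall) :
    digitReal (a + w) = digitSum w + digitReal a := by
  have h := digitSum_sub (weightedTail_ne_top_of_mem_digitBall haw)
    (weightedTail_ne_top_of_mem_digitBall ha)
  rw [add_sub_cancel_left] at h
  rw [digitReal, digitReal, h]
  ring

lemma measurableEmbedding_digitReal : MeasurableEmbedding (digitBall.domRestrict digitReal) :=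
  haveI : PolishSpace digitBall := isClosed_digitBall.polishSpace
  continuousOn_digitReal.domRestrict.measurableEmbedding digitReal_injOn.injective

lemma map_val_comap_domRestrict_apply {α β : Type*} [MeasurableSpace α] [MeasurableSpace β]
    {f : α → β} {s : Set α} (hf : MeasurableEmbedding (s.domRestrict f)) (ρ : Measure β) {N : Set α}
    (hN : MeasurableSet N) :
    (ρ.comap (s.domRestrict f)).map Subtype.val N = ρ (f '' (N ∩ s)) := by
  rw [Measure.map_apply measurable_subtype_coe hN, hf.comap_apply, image_domRestrict]

lemma Measured.exists_isAddQuasiInvariantOn {B : Set ℝ} (hB : Measured B) (hBE : B ⊆ digitSet) :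
    ∃ ν : Measure (ℕ → ℤ), IsProbabilityMeasure ν ∧ (∀ᵐ a ∂ν, a ∈ digitBall) ∧
      IsAddQuasiInvariantOn ν (digitReal ⁻¹' B ∩ digitBall) := by
  obtain ⟨hBm, μ, hμ, hpos, hσ⟩ := hB
  have : NeZero (μ.restrict B) := ⟨by rw [Ne, Measure.restrict_eq_zero]; exact hpos.ne'⟩
  set ρ := (μ.restrict B).toFinite
  have hρ : ρ ≪ μ.restrict B := toFinite_absolutelyContinuous _
  have hρ' : μ.restrict B ≪ ρ := absolutelyContinuous_toFinite _
  have happly := fun {N} => map_val_comap_domRestrict_apply (N := N) measurableEmbedding_digitReal ρ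
  refine ⟨(ρ.comap (digitBall.domRestrict digitReal)).map Subtype.val, ⟨?_⟩, ?_, ?_⟩
  · rw [happly .univ, univ_inter]
    refine prob_compl_eq_zero_iff isCompact_digitSet.measurableSet |>.1 (hρ ?_)
    exact (ae_restrict_mem hBm).mono fun x hx => hBE hx
  · exact (happly isClosed_digitBall.measurableSet.compl).trans (by simp)
  · intro N hN hNB hN0 w
    rw [happly hN, inter_eq_left.2 fun a ha => (hNB ha).2] at hN0
    have hμN : μ (digitReal '' N) = 0 := by
      have h := hρ' hN0
      rwa [Measure.restrict_apply' hBm,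
        inter_eq_left.2 (image_subset_iff.2 fun a ha => (hNB ha).1)] at h
    rw [happly (measurable_add_const w hN)]
    refine hρ (Measure.restrict_le_self.absolutelyContinuous ?_)
    rw [← measure_preimage_add μ (digitSum w)] at hμN
    refine measure_mono_null (image_subset_iff.2 fun a ⟨ha, ha'⟩ => ?_) hμN
    exact ⟨a + w, ha, digitReal_add ha' (hNB ha).2⟩

theorem not_isCountableUnionOf_measured_digitSet : ¬ IsCountableUnionOf Measured digitSet := by
  rintro ⟨𝒜, hcount, hmeas, hunion⟩
  have hne : 𝒜.Nonempty := Nonempty.of_sUnion (hunion ▸ digitSet_nonempty)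
  obtain ⟨B, rfl⟩ := hcount.exists_eq_range hne
  choose ν hprob hν hinv using fun k => (hmeas (B k) ⟨k, rfl⟩).exists_isAddQuasiInvariantOn
    (hunion ▸ subset_sUnion_of_mem ⟨k, rfl⟩)
  refine not_digitBall_subset_iUnion _ (fun k => ?_) ν hν hinv fun a ha => ?_
  · exact (measurable_digitReal (hmeas (B k) ⟨k, rfl⟩).1).inter isClosed_digitBall.measurableSet
  · obtain ⟨_, ⟨k, rfl⟩, hk⟩ : digitReal a ∈ ⋃₀ range B := hunion ▸ mem_image_of_mem _ ha
    exact mem_iUnion.2 ⟨k, hk, ha⟩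

lemma abs_digitReal_sub_truncation_le {a : ℕ → ℤ} (ha : a ∈ digitBall) (n : ℕ) :
    |digitReal a - digitReal ((Iio n).indicator a)| ≤ digitScale n := by
  have htail : weightedTail 0 (a - (Iio n).indicator a) ≤ (1 : ℝ≥0) := by
    refine (ENNReal.tsum_le_tsum fun i => ?_).trans ha
    gcongr
    by_cases hi : i < n <;> simp [hi]
  have hsub := digitSum_sub (weightedTail_ne_top_of_mem_digitBall ha)
    (ne_top_of_le_ne_top ENNReal.coe_ne_top htail)
  rw [sub_sub_cancel] at hsub
  have hle := abs_digitSum_le htail (n := n) fun i hi => by simp [hi]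
  rw [NNReal.coe_one, mul_one] at hle
  rwa [digitReal, digitReal, add_sub_add_left_eq_sub, hsub, sub_sub_cancel]

lemma card_Icc_neg_two_pow_le {i n : ℕ} (hi : i < n) :
    (Finset.Icc (-2 ^ i : ℤ) (2 ^ i)).card ≤ 2 ^ (n + 1) := by
  have h1 : (2 : ℤ) ^ (i + 1) ≤ 2 ^ n := pow_le_pow_right₀ (by norm_num) hi
  have h2 : (1 : ℤ) ≤ 2 ^ n := one_le_pow₀ (by norm_num)
  rw [Int.card_Icc, Int.toNat_le, pow_succ]
  push_cast
  linarith [pow_succ (2 : ℤ) i]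

lemma externalCoveringNumber_digitSet_le (n : ℕ) :
    Metric.externalCoveringNumber (digitScale n) digitSet ≤ (2 ^ (n * (n + 1)) : ℕ) := by
  classical
  let strings := Fintype.piFinset fun i : Fin n => Finset.Icc (-2 ^ (i : ℕ) : ℤ) (2 ^ (i : ℕ))
  let centers := strings.image fun σ => digitReal (Function.extend Fin.val σ 0)
  have hcover : Metric.IsCover (digitScale n) digitSet (centers : Set ℝ) := by
    rintro _ ⟨a, ha, rfl⟩
    refine ⟨digitReal ((Iio n).indicator a), ?_, ?_⟩
    · refine Finset.mem_coe.2 (Finset.mem_image.2 ⟨fun i => a i, ?_, congrArg _ ?_⟩)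
      · exact Fintype.mem_piFinset.2 fun i =>
          Finset.mem_Icc.2 (abs_le.1 (abs_le_of_mem_digitBall ha i))
      · ext i
        by_cases hi : i < n
        · simpa [hi] using Fin.val_injective.extend_apply (fun i : Fin n => a i) 0 ⟨i, hi⟩
        · rw [Function.extend_apply' _ _ _ fun ⟨j, hj⟩ => hi (hj ▸ j.2)]
          simp [hi]
    · change edist _ _ ≤ _
      rw [edist_nndist]
      exact_mod_cast abs_digitReal_sub_truncation_le ha n
  refine hcover.externalCoveringNumber_le_encard.trans ?_
  rw [encard_coe_eq_coe_finsetCard, Nat.cast_le]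
  calc centers.card ≤ ∏ i : Fin n, (Finset.Icc (-2 ^ (i : ℕ) : ℤ) (2 ^ (i : ℕ))).card :=
        Finset.card_image_le.trans (Fintype.card_piFinset _).le
    _ ≤ ∏ _i : Fin n, 2 ^ (n + 1) := Finset.prod_le_prod' fun i _ => card_Icc_neg_two_pow_le i.2
    _ = 2 ^ (n * (n + 1)) := by simp [← pow_mul, mul_comm]

lemma exists_succ_le_lt_of_tendsto {α : Type*} [TopologicalSpace α] [LinearOrder α]
    [OrderTopology α] {r : ℕ → α} {a δ : α} (hr : Tendsto r atTop (𝓝 a)) (hδ : a < δ) {n₀ : ℕ}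
    (h₀ : δ < r n₀) : ∃ n ≥ n₀, r (n + 1) ≤ δ ∧ δ < r n := by
  by_contra! h
  have hlt : ∀ n ≥ n₀, δ < r n := fun n hn =>
    Nat.le_induction h₀ (fun n hn ih => not_le.1 fun hle => (h n hn hle).not_gt ih) n hn
  obtain ⟨n, hn, hle⟩ := ((eventually_ge_atTop n₀).and (hr.eventually_le_const hδ)).exists
  exact (hlt n hn).not_ge hle

lemma hasBoxDimension_zero_of_scales {E : Set ℝ} (hne : E.Nonempty) (hE : Bornology.IsBounded E)
    {r : ℕ → ℝ≥0} {N : ℕ → ℕ} (hr0 : ∀ n, 0 < r n) (hr : Tendsto r atTop (𝓝 0))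
    (hN : ∀ n, Metric.externalCoveringNumber (r n) E ≤ N n)
    (hlog : Tendsto (fun n => Real.log (N (n + 1)) / Real.log (1 / r n)) atTop (𝓝 0)) :
    HasBoxDimension E 0 := by
  refine ⟨hne, hE, Metric.tendsto_nhds.2 fun η hη => ?_⟩
  obtain ⟨n₀, hn₀⟩ := eventually_atTop.1
    ((hlog.eventually_lt_const hη).and (hr.eventually_lt_const one_pos))
  filter_upwards [Ioo_mem_nhdsGT (hr0 n₀)] with δ ⟨hδ, hδn₀⟩
  obtain ⟨n, hn, hn_le, hlt_n⟩ := exists_succ_le_lt_of_tendsto hr hδ hδn₀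
  obtain ⟨hη_n, hr1⟩ := hn₀ n hn
  have hcard : (Metric.externalCoveringNumber δ E).toNat ≤ N (n + 1) :=
    ENat.toNat_le_of_le_natCast ((Metric.externalCoveringNumber_anti hn_le).trans (hN _))
  have hden : 0 < Real.log (1 / r n) :=
    Real.log_pos ((one_lt_div (hr0 n)).2 (by exact_mod_cast hr1))
  have hden_le : Real.log (1 / r n) ≤ Real.log (1 / δ) :=
    Real.log_le_log (one_div_pos.2 (hr0 n)) (one_div_le_one_div_of_le hδ hlt_n.le)
  rw [dist_zero_right, Real.norm_of_nonneg
    (div_nonneg (Real.log_natCast_nonneg _) (hden.le.trans hden_le))]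
  refine lt_of_le_of_lt ?_ hη_n
  refine div_le_div₀ (Real.log_natCast_nonneg _) ?_ hden hden_le
  obtain h0 | h0 := Nat.eq_zero_or_pos (Metric.externalCoveringNumber δ E).toNat
  · simp [h0, Real.log_natCast_nonneg]
  · gcongr

theorem hasBoxDimension_digitSet : HasBoxDimension digitSet 0 := by
  refine hasBoxDimension_zero_of_scales digitSet_nonempty isCompact_digitSet.isBounded
    digitScale_pos (NNReal.tendsto_atTop_zero_of_summable summable_digitScale)
    externalCoveringNumber_digitSet_le ?_
  have hratio : ∀ n : ℕ, Real.log ((2 ^ ((n + 1) * (n + 1 + 1)) : ℕ) : ℝ) /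
      Real.log (1 / digitScale n) = 1 / (n + 1 : ℝ) + (1 / (n + 1 : ℝ)) ^ 2 := fun n => by
    have hlog2 : Real.log 2 ≠ 0 := (Real.log_pos one_lt_two).ne'
    simp only [digitScale, one_div, inv_pow, NNReal.coe_inv, NNReal.coe_pow, NNReal.coe_ofNat,
      inv_inv, Nat.cast_pow, Nat.cast_ofNat, Real.log_pow]
    push_cast
    field_simp
  simp only [hratio]
  simpa using tendsto_one_div_add_atTop_nhds_zero_nat.add
    (tendsto_one_div_add_atTop_nhds_zero_nat (𝕜 := ℝ).pow 2)

/-! ### The space `C¹([0,1])` -/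

open scoped Polynomial

lemma forall_hasDerivWithinAt_Icc_iff_eq_integral
    (p : C(Icc (0 : ℝ) 1, ℝ) × C(Icc (0 : ℝ) 1, ℝ)) :
    (∀ x : Icc (0 : ℝ) 1,
      HasDerivWithinAt (IccExtend zero_le_one p.1) (p.2 x) (Icc (0 : ℝ) 1) (x : ℝ)) ↔
    ∀ x : Icc (0 : ℝ) 1, p.1 x = p.1 0 + ∫ t in (0 : ℝ)..x, IccExtend zero_le_one p.2 t := by
  have hcont : Continuous (IccExtend zero_le_one p.1) := p.1.continuous.Icc_extend'
  have hcont' : Continuous (IccExtend zero_le_one p.2) := p.2.continuous.Icc_extend'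
  refine ⟨fun h x => ?_, fun h x => ?_⟩
  · rw [intervalIntegral.integral_eq_sub_of_hasDerivAt_of_le (f := IccExtend zero_le_one p.1) x.2.1
      hcont.continuousOn (fun t ht => ?_) (hcont'.intervalIntegrable _ _), IccExtend_val,
      IccExtend_left]
    · exact (add_sub_cancel _ _).symm
    · have ht' : t ∈ Icc (0 : ℝ) 1 := ⟨ht.1.le, ht.2.le.trans x.2.2⟩
      rw [IccExtend_of_mem _ _ ht']
      exact (h ⟨t, ht'⟩).hasDerivAt (Icc_mem_nhds ht.1 (ht.2.trans_le x.2.2))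
  · have hderiv := ((hcont'.integral_hasStrictDerivAt 0 (x : ℝ)).hasDerivAt.const_add
      (p.1 0)).hasDerivWithinAt (s := Icc (0 : ℝ) 1)
    rw [IccExtend_val] at hderiv
    exact hderiv.congr (fun t ht => by rw [IccExtend_of_mem _ _ ht, h ⟨t, ht⟩])
      (by rw [IccExtend_val, h x])

lemma lipschitzWith_integral_IccExtend (x : Icc (0 : ℝ) 1) :
    LipschitzWith 1 fun f : C(Icc (0 : ℝ) 1, ℝ) =>
      ∫ t in (0 : ℝ)..x, IccExtend zero_le_one f t := by
  have hint : ∀ f : C(Icc (0 : ℝ) 1, ℝ),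
      IntervalIntegrable (IccExtend zero_le_one f) volume 0 (x : ℝ) :=
    fun f => f.continuous.Icc_extend'.intervalIntegrable _ _
  refine LipschitzWith.of_dist_le_mul fun f g => ?_
  calc dist (∫ t in (0 : ℝ)..x, IccExtend zero_le_one f t)
        (∫ t in (0 : ℝ)..x, IccExtend zero_le_one g t)
      = ‖∫ t in (0 : ℝ)..x, (IccExtend zero_le_one f t - IccExtend zero_le_one g t)‖ := by
        rw [dist_eq_norm, intervalIntegral.integral_sub (hint f) (hint g)]
    _ ≤ dist f g * |(x : ℝ) - 0| :=
        intervalIntegral.norm_integral_le_of_norm_le_const fun t _ =>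
          (dist_eq_norm _ _).symm.trans_le (ContinuousMap.dist_apply_le_dist _)
    _ ≤ (1 : ℝ≥0) * dist f g := by
        rw [sub_zero, abs_of_nonneg x.2.1, NNReal.coe_one, one_mul]
        exact mul_le_of_le_one_right dist_nonneg x.2.2

instance : CompleteSpace C1Unit := by
  refine IsClosed.completeSpace_coe (s := {p : C(Icc (0 : ℝ) 1, ℝ) × C(Icc (0 : ℝ) 1, ℝ) |
    ∀ x : Icc (0 : ℝ) 1,
      HasDerivWithinAt (IccExtend zero_le_one p.1) (p.2 x) (Icc (0 : ℝ) 1) (x : ℝ)}) (hs := ?_)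
  simp only [forall_hasDerivWithinAt_Icc_iff_eq_integral, ofPred_forall]
  exact isClosed_iInter fun x => isClosed_eq (by fun_prop) <| (by fun_prop : Continuous _).add <|
    (lipschitzWith_integral_IccExtend x).continuous.comp continuous_snd

namespace C1Unit

/-- The function `h + s g`. -/
noncomputable def addSMul (h g : C1Unit) (s : ℝ) : C1Unit :=
  ⟨(h.1.1 + s • g.1.1, h.1.2 + s • g.1.2), fun x => by
    refine ((h.2 x).add ((g.2 x).const_mul s)).congr (fun y hy => ?_) ?_
    · simp [IccExtend_of_mem _ _ hy]
    · simp⟩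

lemma continuous_addSMul (h g : C1Unit) : Continuous (h.addSMul g) := by
  unfold addSMul
  fun_prop

lemma addSMul_zero (h g : C1Unit) : h.addSMul g 0 = h := by
  ext <;> simp [addSMul]

/-- A polynomial as an element of `C¹([0,1])`. -/
noncomputable def ofPolynomial (p : ℝ[X]) : C1Unit :=
  ⟨(p.toContinuousMapOn _, p.derivative.toContinuousMapOn _), fun x => by
    refine (p.hasDerivAt (x : ℝ)).hasDerivWithinAt.congr (fun y hy => ?_) ?_
    · simp [IccExtend_of_mem _ _ hy]
    · simp⟩

lemma lipschitzWith (h : C1Unit) : LipschitzWith ‖h.1.2‖₊ h.1.1 := by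
  have hlip := (convex_Icc (0 : ℝ) 1).lipschitzOnWith_of_nnnorm_hasDerivWithin_le
    (f := IccExtend zero_le_one h.1.1) (f' := IccExtend zero_le_one h.1.2) (C := ‖h.1.2‖₊)
    (fun x hx => by simpa [IccExtend_of_mem _ _ hx] using h.2 ⟨x, hx⟩)
    (fun x _ => h.1.2.norm_coe_le_norm _)
  exact fun x y => by simpa [IccExtend_val, Subtype.edist_eq] using hlip x.2 y.2

lemma isBiLipschitz_of_norm_deriv_sub_one_lt {h : C1Unit} (hh : ‖h.1.2 - 1‖₊ < 1) :
    h.IsBiLipschitz := by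
  set g := h.addSMul (ofPolynomial Polynomial.X) (-1)
  have hderiv : g.1.2 = h.1.2 - 1 := by
    ext
    simp [g, addSMul, ofPolynomial, sub_eq_add_neg]
  have hsum : ⇑h.1.1 = fun x : Icc (0 : ℝ) 1 => x + g.1.1 x := by
    ext
    simp [g, addSMul, ofPolynomial]
  refine ⟨_, (1⁻¹ - ‖g.1.2‖₊)⁻¹, h.lipschitzWith, ?_⟩
  rw [hsum]
  exact (AntilipschitzWith.subtype_coe _).add_lipschitzWith g.lipschitzWith
    (by rwa [hderiv, inv_one])

end C1Unit

/-! ### Products of sets of small box dimension -/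

lemma HasBoxDimension.nonneg {E : Set ℝ} {d : ℝ} (hE : HasBoxDimension E d) : 0 ≤ d := by
  refine ge_of_tendsto hE.2.2 ?_
  filter_upwards [Ioo_mem_nhdsGT one_pos] with δ hδ
  exact div_nonneg (Real.log_natCast_nonneg _) (Real.log_nonneg (one_le_one_div hδ.1 hδ.2.le))

lemma HasBoxDimension.eventually_pow_le_rpow {E : Set ℝ} {d s : ℝ} (hE : HasBoxDimension E d)
    {n : ℕ} (hs : n * d < s) :
    ∀ᶠ δ : ℝ≥0 in 𝓝[>] 0, ((Metric.externalCoveringNumber δ E).toNat : ℝ≥0) ^ n ≤ δ ^ (-s) := by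
  filter_upwards [(hE.2.2.const_mul (n : ℝ)).eventually_lt_const hs, Ioo_mem_nhdsGT one_pos]
    with δ hratio ⟨hδ0, hδ1⟩
  have hlog : 0 < Real.log (1 / δ) := Real.log_pos ((one_lt_div hδ0).2 hδ1)
  rw [← mul_div_assoc, div_lt_iff₀ hlog, one_div, Real.log_inv] at hratio
  rw [← NNReal.coe_le_coe]
  push_cast
  calc ((Metric.externalCoveringNumber δ E).toNat : ℝ) ^ n
      ≤ Real.exp (n * Real.log (Metric.externalCoveringNumber δ E).toNat) := by
        rw [← Real.log_pow]
        exact Real.le_exp_log _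
    _ ≤ Real.exp (Real.log δ * -s) := Real.exp_le_exp.2 (by linarith)
    _ = δ ^ (-s) := (Real.rpow_def_of_pos hδ0 _).symm

lemma exists_finset_isCover_card_eq {X : Type*} [PseudoEMetricSpace X] {δ : ℝ≥0} (hδ : δ ≠ 0)
    {A : Set X} (hA : TotallyBounded A) :
    ∃ C : Finset X, Metric.IsCover δ A C ∧ C.card = (Metric.externalCoveringNumber δ A).toNat := by
  obtain ⟨C₀, -, hfin, hC₀⟩ := Metric.exists_finite_isCover_of_totallyBounded hδ hA
  have : Nonempty {C : Set X // Metric.IsCover δ A C} := ⟨C₀, hC₀⟩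
  obtain ⟨⟨C, hC⟩, hmin⟩ :=
    ENat.exists_eq_iInf fun C : {C : Set X // Metric.IsCover δ A C} => C.1.encard
  rw [iInf_subtype] at hmin
  have hfinC : C.Finite := encard_lt_top_iff.1 <|
    hmin.trans_lt (hC₀.externalCoveringNumber_le_encard.trans_lt hfin.encard_lt_top)
  lift C to Finset X using hfinC
  refine ⟨C, hC, ?_⟩
  rw [Metric.externalCoveringNumber, ← hmin, encard_coe_eq_coe_finsetCard, ENat.toNat_natCast]

lemma hausdorffMeasure_pi_le_liminf {ι X : Type*} [Fintype ι] [EMetricSpace X]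
    [MeasurableSpace X] [BorelSpace X] [SecondCountableTopology X] {A : Set X}
    (hA : TotallyBounded A) {s : ℝ} (hs : 0 ≤ s) :
    μH[s] (univ.pi fun _ : ι => A) ≤
      liminf (fun δ : ℝ≥0 => (((Metric.externalCoveringNumber δ A).toNat ^ Fintype.card ι *
        (2 * δ) ^ s : ℝ≥0) : ℝ≥0∞)) (𝓝[>] 0) := by
  classical
  choose! C hC hcard using fun (δ : ℝ≥0) (hδ : δ ≠ 0) => exists_finset_isCover_card_eq hδ hA
  let t : ∀ δ : ℝ≥0, Fintype.piFinset (fun _ : ι => C δ) → Set (ι → X) :=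
    fun δ p => Metric.closedEBall p.1 δ
  have ht : ∀ δ p, Metric.ediam (t δ p) ≤ ((2 * δ : ℝ≥0) : ℝ≥0∞) := fun δ p =>
    Metric.ediam_closedEBall_le.trans_eq (by simp)
  have hcover : ∀ᶠ δ in 𝓝[>] 0, (univ.pi fun _ : ι => A) ⊆ ⋃ p, t δ p := by
    filter_upwards [self_mem_nhdsWithin] with δ hδ x hx
    choose p hp hxp using fun i => hC δ (ne_of_gt hδ) (hx i trivial)
    exact mem_iUnion.2 ⟨⟨p, Fintype.mem_piFinset.2 hp⟩, edist_pi_le_iff.2 hxp⟩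
  have hdiam : Tendsto (fun δ : ℝ≥0 => ((2 * δ : ℝ≥0) : ℝ≥0∞)) (𝓝[>] 0) (𝓝 0) := by
    have hcont := (continuous_const_mul (2 : ℝ≥0)).tendsto 0
    rw [mul_zero] at hcont
    exact ENNReal.tendsto_coe.2 (hcont.mono_left nhdsWithin_le_nhds)
  refine (Measure.hausdorffMeasure_le_liminf_sum s _ _ hdiam t (.of_forall ht) hcover).trans
    (liminf_le_liminf ?_)
  filter_upwards [self_mem_nhdsWithin] with δ hδ
  calc ∑ p, Metric.ediam (t δ p) ^ s
      ≤ ∑ _p : Fintype.piFinset (fun _ : ι => C δ), ((2 * δ : ℝ≥0) : ℝ≥0∞) ^ s :=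
        Finset.sum_le_sum fun p _ => ENNReal.rpow_le_rpow (ht δ p) hs
    _ = _ := by simp [ENNReal.coe_rpow_of_nonneg _ hs, hcard δ (ne_of_gt hδ)]

theorem HasBoxDimension.hausdorffMeasure_pi_eq_zero {ι : Type*} [Fintype ι] {E : Set ℝ} {d s : ℝ}
    (hE : HasBoxDimension E d) (hs : Fintype.card ι * d < s) :
    μH[s] (univ.pi fun _ : ι => E) = 0 := by
  obtain ⟨s', hs', hs's⟩ := exists_between hs
  have hs0 : 0 ≤ s := (mul_nonneg (Nat.cast_nonneg _) hE.nonneg).trans hs.le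
  have hle : ∀ᶠ δ in 𝓝[>] 0, (((Metric.externalCoveringNumber δ E).toNat ^ Fintype.card ι *
      (2 * δ) ^ s : ℝ≥0) : ℝ≥0∞) ≤ ((2 ^ s * δ ^ (s - s') : ℝ≥0) : ℝ≥0∞) := by
    filter_upwards [hE.eventually_pow_le_rpow hs', self_mem_nhdsWithin] with δ hN hδ
    rw [ENNReal.coe_le_coe, ← neg_add_eq_sub, NNReal.rpow_add (ne_of_gt hδ), NNReal.mul_rpow,
      mul_left_comm]
    gcongr
  have hlim : Tendsto (fun δ : ℝ≥0 => ((2 ^ s * δ ^ (s - s') : ℝ≥0) : ℝ≥0∞)) (𝓝[>] 0) (𝓝 0) := by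
    have hcont := (NNReal.continuous_rpow_const (sub_pos.2 hs's).le).const_mul (2 ^ s) |>.tendsto 0
    rw [NNReal.zero_rpow (sub_pos.2 hs's).ne', mul_zero] at hcont
    exact ENNReal.tendsto_coe.2 (hcont.mono_left nhdsWithin_le_nhds)
  exact le_antisymm ((hausdorffMeasure_pi_le_liminf
    (hE.2.1.isCompact_closure.totallyBounded.subset subset_closure) hs0).trans
      ((liminf_le_liminf hle).trans hlim.liminf_eq.le)) zero_le

lemma isTotallyDisconnected_of_volume_eq_zero {E : Set ℝ} (hE : volume E = 0) :
    IsTotallyDisconnected E := by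
  refine isTotallyDisconnected_iff_lt.2 fun x _ y _ hxy => ?_
  have hpos : volume (Ioo x y) ≠ 0 := (isOpen_Ioo.measure_pos volume (nonempty_Ioo.2 hxy)).ne'
  obtain ⟨z, hz, hzE⟩ := not_subset.1 fun hsub => hpos (measure_mono_null hsub hE)
  exact ⟨z, hzE, hz⟩

lemma exists_continuous_nat_dist_lt (X : Type*) [MetricSpace X] [CompactSpace X]
    [TotallyDisconnectedSpace X] {ε : ℝ} (hε : 0 < ε) :
    ∃ c : X → ℕ, Continuous c ∧ ∀ x y, c x = c y → dist x y < ε := by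
  have hS : {p : X × X | dist p.1 p.2 < ε / 2} ∈ nhdsSet (diagonal X) :=
    (isOpen_lt (by fun_prop) continuous_const).mem_nhdsSet.2 <| by
      rintro ⟨x, y⟩ (rfl : x = y)
      simpa using hε
  obtain ⟨n, c, r, hc, hr⟩ :=
    (ContinuousMap.id X).exists_finite_approximation_of_mem_nhds_diagonal hS
  refine ⟨fun x => c x, continuous_of_discreteTopology.comp hc, fun x y hxy => ?_⟩
  have hy := hr y
  rw [← Fin.ext hxy] at hy
  exact (dist_triangle_right x y _).trans_lt ((add_lt_add (hr x) hy).trans_eq (add_halves ε))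

lemma volume_eq_zero_of_hausdorffMeasure_pi {ι : Type*} [Fintype ι] [Nonempty ι] {E : Set ℝ}
    (hE : μH[1] (univ.pi fun _ : ι => E) = 0) : volume E = 0 := by
  obtain ⟨i⟩ := ‹Nonempty ι›
  have hle := (LipschitzWith.eval (α := fun _ : ι => ℝ) i).hausdorffMeasure_image_le
    zero_le_one (univ.pi fun _ : ι => E)
  rw [hE, mul_zero, hausdorffMeasure_real] at hle
  have hsub : E ⊆ Function.eval i '' univ.pi fun _ => E := fun x hx =>
    ⟨fun _ => x, fun _ _ => hx, rfl⟩
  exact measure_mono_null hsub (le_antisymm hle zero_le)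

lemma not_lt_of_two_pow_add_eq {a b c d : ℕ} (hba : b ≤ a) (h : 2 ^ a + 2 ^ b = 2 ^ c + 2 ^ d) :
    ¬ a < c := fun hac => by
  have hb : 2 ^ b ≤ 2 ^ a := Nat.pow_le_pow_right two_pos hba
  have hc : 2 ^ (a + 1) ≤ 2 ^ c := Nat.pow_le_pow_right two_pos hac
  have hd : 0 < 2 ^ d := Nat.two_pow_pos d
  omega

lemma two_pow_add_eq {a b c d : ℕ} (hba : b ≤ a) (hdc : d ≤ c)
    (h : 2 ^ a + 2 ^ b = 2 ^ c + 2 ^ d) : a = c ∧ b = d := by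
  obtain rfl : a = c := le_antisymm (not_lt.1 (not_lt_of_two_pow_add_eq hdc h.symm))
    (not_lt.1 (not_lt_of_two_pow_add_eq hba h))
  exact ⟨rfl, Nat.pow_right_injective le_rfl (Nat.add_left_cancel h)⟩

lemma one_le_abs_two_pow_sub {i j k l : ℕ} (hij : i ≠ j) (hik : i ≠ k) :
    (1 : ℝ) ≤ |2 ^ i - 2 ^ j - 2 ^ k + 2 ^ l| := by
  have hne : (2 ^ i - 2 ^ j - 2 ^ k + 2 ^ l : ℤ) ≠ 0 := fun h0 => by
    have hsum : 2 ^ i + 2 ^ l = 2 ^ j + 2 ^ k := by zify; linarith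
    rcases le_total l i with hli | hil <;> rcases le_total k j with hkj | hjk
    · exact hij (two_pow_add_eq hli hkj hsum).1
    · exact hik (two_pow_add_eq hli hjk (by omega)).1
    · exact hik (two_pow_add_eq hil hkj (by omega)).2
    · exact hij (two_pow_add_eq hil hjk (by omega)).2
  exact_mod_cast Int.one_le_abs hne

lemma lipschitzOnWith_div {X : Type*} [PseudoMetricSpace X] {f g : X → ℝ} {s : Set X}
    {K L M c : ℝ≥0} (hf : LipschitzOnWith K f s) (hg : LipschitzOnWith L g s) (hc : 0 < c)
    (hM : ∀ x ∈ s, |f x| ≤ M) (hgc : ∀ x ∈ s, c ≤ |g x|) :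
    LipschitzOnWith (K / c + M * L / c ^ 2) (fun x => f x / g x) s := by
  refine LipschitzOnWith.of_dist_le_mul fun x hx y hy => ?_
  have hgx : g x ≠ 0 := abs_pos.1 ((NNReal.coe_pos.2 hc).trans_le (hgc x hx))
  have hgy : g y ≠ 0 := abs_pos.1 ((NNReal.coe_pos.2 hc).trans_le (hgc y hy))
  calc dist (f x / g x) (f y / g y)
      = |(f x - f y) / g x + f y * (g y - g x) / (g x * g y)| := by
        rw [Real.dist_eq]
        congr 1
        field_simp
        ring
    _ ≤ |f x - f y| / |g x| + |f y| * |g y - g x| / (|g x| * |g y|) := by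
        refine (abs_add_le _ _).trans_eq ?_
        rw [abs_div, abs_div, abs_mul, abs_mul]
    _ ≤ K * dist x y / c + M * (L * dist x y) / (c * c) := by
        have hfxy := hf.dist_le_mul x hx y hy
        have hgxy := hg.dist_le_mul y hy x hx
        rw [Real.dist_eq] at hfxy hgxy
        rw [dist_comm y x] at hgxy
        have := hM y hy
        have := hgc x hx
        have := hgc y hy
        gcongr
    _ = (K / c + M * L / c ^ 2 : ℝ≥0) * dist x y := by
        push_cast
        ring

lemma volume_image_div_eq_zero {X : Type*} [MetricSpace X] [MeasurableSpace X] [BorelSpace X]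
    {s : Set X} (hs : IsCompact s) (hs0 : μH[1] s = 0) {f g : X → ℝ} {K L : ℝ≥0}
    (hf : LipschitzWith K f) (hg : LipschitzWith L g) (hne : ∀ x ∈ s, g x ≠ 0) :
    volume ((fun x => f x / g x) '' s) = 0 := by
  obtain ⟨M, hM⟩ := hs.exists_bound_of_continuousOn hf.continuous.continuousOn
  obtain ⟨c, hc, hgc⟩ := hs.exists_forall_le' hg.continuous.abs.continuousOn
    fun x hx => abs_pos.2 (hne x hx)
  lift c to ℝ≥0 using hc.le
  have hlip := lipschitzOnWith_div (hf.lipschitzOnWith (s := s)) hg.lipschitzOnWith hc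
    (fun x hx => (hM x hx).trans (Real.le_coe_toNNReal M)) hgc
  have hle := hlip.hausdorffMeasure_image_le zero_le_one
  rw [hs0, mul_zero, hausdorffMeasure_real] at hle
  exact le_antisymm hle zero_le

section Quadruples

variable {X : Type*}

/-- The second difference `g x - g y - g u + g v` of a quadruple `(x, y, u, v)`; it vanishes exactly
when `g x - g y = g u - g v`. -/
def quadDiff (g : X → ℝ) (q : Fin 4 → X) : ℝ :=
  g (q 0) - g (q 1) - g (q 2) + g (q 3)

lemma abs_quadDiff_sub_quadDiff_lt {f g : X → ℝ} {ε : ℝ} {q : Fin 4 → X}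
    (h : ∀ i, |f (q i) - g (q i)| < ε) : |quadDiff f q - quadDiff g q| < 4 * ε := by
  simp only [abs_lt] at h ⊢
  simp only [quadDiff]
  constructor <;> linarith [h 0, h 1, h 2, h 3]

lemma lipschitzWith_quadDiff [PseudoMetricSpace X] {g : X → ℝ} {K : ℝ≥0} (hg : LipschitzWith K g) :
    LipschitzWith (4 * K) (quadDiff g) := by
  have heval : ∀ i : Fin 4, LipschitzWith K fun q : Fin 4 → X => g (q i) := fun i => by
    have hcomp := hg.comp (LipschitzWith.eval (α := fun _ : Fin 4 => X) i)
    rwa [mul_one] at hcomp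
  have hsum := (((heval 0).sub (heval 1)).sub (heval 2)).add (heval 3)
  rwa [show K + K + K + K = 4 * K by ring] at hsum

/-- The quadruples `(x, y, u, v)` in `A` whose first point has distance at least `ε` from the second
and from the third. -/
def sepQuads [PseudoMetricSpace X] (A : Set X) (ε : ℝ) : Set (Fin 4 → X) :=
  {q ∈ univ.pi fun _ => A | ε ≤ dist (q 0) (q 1) ∧ ε ≤ dist (q 0) (q 2)}

lemma isCompact_sepQuads [PseudoMetricSpace X] {A : Set X} (hA : IsCompact A) (ε : ℝ) :
    IsCompact (sepQuads A ε) :=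
  have hclosed : ∀ i : Fin 4, IsClosed {q : Fin 4 → X | ε ≤ dist (q 0) (q i)} := fun i =>
    isClosed_le continuous_const (by fun_prop)
  (isCompact_univ_pi fun _ => hA).inter_right ((hclosed 1).inter (hclosed 2))

end Quadruples

lemma quadDiff_addSMul (h g : C1Unit) (s : ℝ) (q : Fin 4 → Icc (0 : ℝ) 1) :
    quadDiff (h.addSMul g s).1.1 q = quadDiff h.1.1 q + s * quadDiff g.1.1 q := by
  simp only [quadDiff, C1Unit.addSMul, ContinuousMap.add_apply, ContinuousMap.smul_apply,
    smul_eq_mul]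
  ring

section Typical

variable {A : Set (Icc (0 : ℝ) 1)} {ε : ℝ}

lemma isOpen_forall_quadDiff_ne_zero (hA : IsCompact A) (ε : ℝ) :
    IsOpen {h : C1Unit | ∀ q ∈ sepQuads A ε, quadDiff h.1.1 q ≠ 0} := by
  refine isOpen_iff_mem_nhds.2 fun h hh => ?_
  refine (isCompact_sepQuads hA ε).eventually_forall_of_forall_eventually fun q hq => ?_
  have hcont : Continuous fun z : C1Unit × (Fin 4 → Icc (0 : ℝ) 1) => quadDiff z.1.1.1 z.2 := by
    unfold quadDiff
    fun_prop
  exact hcont.continuousAt.eventually_ne (hh q hq)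

/-- The witness approximates a function which is constant on small clopen pieces of `A`, with
distinct powers of two as values: these form a Sidon set. -/
lemma exists_quadDiff_ne_zero (hA : IsCompact A) (hdisc : IsTotallyDisconnected A) (hε : 0 < ε) :
    ∃ g : C1Unit, ∀ q ∈ sepQuads A ε, quadDiff g.1.1 q ≠ 0 := by
  have : CompactSpace A := isCompact_iff_compactSpace.1 hA
  have : TotallyDisconnectedSpace A := totallyDisconnectedSpace_subtype_iff.2 hdisc
  obtain ⟨c, hc, hcε⟩ := exists_continuous_nat_dist_lt A hε
  have hcont : Continuous fun x => (2 : ℝ) ^ c x :=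
    (continuous_of_discreteTopology (f := fun n : ℕ => (2 : ℝ) ^ n)).comp hc
  obtain ⟨G, hG⟩ := ContinuousMap.exists_restrict_eq hA.isClosed ⟨_, hcont⟩
  obtain ⟨p, hp⟩ := exists_polynomial_near_continuousMap 0 1 G (1 / 4) (by norm_num)
  refine ⟨C1Unit.ofPolynomial p, fun q ⟨hqA, h01, h02⟩ h0 => ?_⟩
  let r : Fin 4 → A := fun i => ⟨q i, hqA i trivial⟩
  have hsep : 1 ≤ |quadDiff G q| := by
    have hGr : ∀ i, G (q i) = 2 ^ c (r i) := fun i => DFunLike.congr_fun hG (r i)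
    simp only [quadDiff, hGr]
    exact one_le_abs_two_pow_sub (fun h => (hcε _ _ h).not_ge h01)
      fun h => (hcε _ _ h).not_ge h02
  have hnear := abs_quadDiff_sub_quadDiff_lt (f := (C1Unit.ofPolynomial p).1.1) (g := G) (q := q)
    fun i => ((C1Unit.ofPolynomial p).1.1 - G).norm_coe_le_norm (q i) |>.trans_lt hp
  rw [h0, zero_sub, abs_neg] at hnear
  linarith

/-- With `g` from `exists_quadDiff_ne_zero`, the parameters `s` for which `h + s g` is not in the
set are the values of `-quadDiff h / quadDiff g` on a null set. -/
lemma dense_forall_quadDiff_ne_zero (hA : IsCompact A) (hdisc : IsTotallyDisconnected A)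
    (hA4 : μH[1] (univ.pi fun _ : Fin 4 => A) = 0) (hε : 0 < ε) :
    Dense {h : C1Unit | ∀ q ∈ sepQuads A ε, quadDiff h.1.1 q ≠ 0} := by
  obtain ⟨g, hg⟩ := exists_quadDiff_ne_zero hA hdisc hε
  refine dense_iff_inter_open.2 fun O hO ⟨h, hh⟩ => ?_
  have hpos := (hO.preimage (h.continuous_addSMul g)).measure_pos volume
    ⟨0, by rwa [mem_preimage, C1Unit.addSMul_zero]⟩
  have hnull := volume_image_div_eq_zero (isCompact_sepQuads hA ε)
    (measure_mono_null (sep_subset _ _) hA4) (lipschitzWith_quadDiff h.lipschitzWith).neg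
    (lipschitzWith_quadDiff g.lipschitzWith) hg
  obtain ⟨s, hsO, hs⟩ := not_subset.1 fun hsub => hpos.ne' (measure_mono_null hsub hnull)
  refine ⟨h.addSMul g s, hsO, fun q hq h0 => hs ⟨q, hq, ?_⟩⟩
  rw [quadDiff_addSMul] at h0
  exact (div_eq_iff (hg q hq)).2 (neg_eq_of_add_eq_zero_right h0)

end Typical

lemma onlyTrivialDifferences_image {X : Type*} [MetricSpace X] {A : Set X} {h : X → ℝ}
    (hh : ∀ n : ℕ, ∀ q ∈ sepQuads A (1 / (n + 1)), quadDiff h q ≠ 0) :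
    OnlyTrivialDifferences (h '' A) := by
  rintro _ ⟨x, hx, rfl⟩ _ ⟨y, hy, rfl⟩ _ ⟨u, hu, rfl⟩ _ ⟨v, hv, rfl⟩ heq
  by_contra hcon
  have hxu : x ≠ u := by
    rintro rfl
    exact hcon (Or.inl ⟨rfl, by linarith⟩)
  have hxy : x ≠ y := by
    rintro rfl
    exact hcon (Or.inr ⟨rfl, by linarith⟩)
  obtain ⟨n, hn⟩ := exists_nat_one_div_lt (lt_min (dist_pos.2 hxy) (dist_pos.2 hxu))
  refine hh n ![x, y, u, v] ⟨?_, hn.le.trans (min_le_left _ _), hn.le.trans (min_le_right _ _)⟩ ?_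
  · simp [Set.mem_pi, Fin.forall_fin_succ, hx, hy, hu, hv]
  · change h x - h y - h u + h v = 0
    linarith

theorem eventually_residual_onlyTrivialDifferences {E : Set ℝ} {d : ℝ} (hE : IsCompact E)
    (hdim : HasBoxDimension E d) (hd : 4 * d < 1) :
    ∀ᶠ h in residual C1Unit, OnlyTrivialDifferences (h.img E) := by
  set A : Set (Icc (0 : ℝ) 1) := Subtype.val ⁻¹' E
  have hA : IsCompact A := (hE.isClosed.preimage continuous_subtype_val).isCompact
  have hE4 : μH[1] (univ.pi fun _ : Fin 4 => E) = 0 :=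
    hdim.hausdorffMeasure_pi_eq_zero (by simpa using hd)
  have hA4 : μH[1] (univ.pi fun _ : Fin 4 => A) = 0 := by
    have hval : Isometry fun (q : Fin 4 → Icc (0 : ℝ) 1) i => (q i : ℝ) :=
      Isometry.piMap _ fun _ => isometry_subtype_coe
    rw [← hval.hausdorffMeasure_image (Or.inl zero_le_one)]
    refine measure_mono_null ?_ hE4
    rintro _ ⟨q, hq, rfl⟩ i hi
    exact hq i hi
  have hdisc : IsTotallyDisconnected A := IsEmbedding.subtypeVal.isTotallyDisconnected_image.1 <|
    isTotallyDisconnected_of_volume_eq_zero <|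
      measure_mono_null (image_preimage_subset _ _) (volume_eq_zero_of_hausdorffMeasure_pi hE4)
  filter_upwards [eventually_countable_forall.2 fun n : ℕ =>
    residual_of_dense_open (isOpen_forall_quadDiff_ne_zero hA (1 / (n + 1)))
      (dense_forall_quadDiff_ne_zero hA hdisc hA4 (by positivity))] with h hh
  exact onlyTrivialDifferences_image hh

lemma exists_isBiLipschitz_of_eventually_residual {P : C1Unit → Prop}
    (hP : ∀ᶠ h in residual C1Unit, P h) : ∃ f : C1Unit, f.IsBiLipschitz ∧ P f := by
  have hopen : IsOpen {h : C1Unit | ‖h.1.2 - 1‖₊ < 1} := isOpen_lt (by fun_prop) continuous_const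
  have hid : (C1Unit.ofPolynomial Polynomial.X).1.2 = 1 := by
    ext
    simp [C1Unit.ofPolynomial]
  obtain ⟨f, hf, hPf⟩ := (dense_of_mem_residual hP).inter_open_nonempty _ hopen
    ⟨C1Unit.ofPolynomial Polynomial.X, by simp [hid]⟩
  exact ⟨f, C1Unit.isBiLipschitz_of_norm_deriv_sub_one_lt hf, hPf⟩

/-! ### Hausdorff measures and Lipschitz maps -/

lemma exists_cover_tsum_lt_of_mkMetric_lt {X : Type*} [EMetricSpace X] [MeasurableSpace X]
    [BorelSpace X] {m : ℝ≥0∞ → ℝ≥0∞} {A : Set X} {c r : ℝ≥0∞} (hc : Measure.mkMetric m A < c)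
    (hr : 0 < r) :
    ∃ t : ℕ → Set X, A ⊆ iUnion t ∧ (∀ k, Metric.ediam (t k) ≤ r) ∧
      ∑' k, ⨆ _ : (t k).Nonempty, m (Metric.ediam (t k)) < c := by
  rw [Measure.mkMetric_apply] at hc
  have hrc := (le_iSup₂ (f := fun (r : ℝ≥0∞) (_ : 0 < r) => ⨅ (t : ℕ → Set X) (_ : A ⊆ iUnion t)
    (_ : ∀ k, Metric.ediam (t k) ≤ r), ∑' k, ⨆ _ : (t k).Nonempty, m (Metric.ediam (t k)))
    r hr).trans_lt hc
  simpa only [iInf_lt_iff, exists_prop] using hrc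

lemma exists_subset_iUnion_Icc {S : Set ℝ} {K : ℝ≥0} {d : ℝ} (hd : 0 ≤ d)
    (hS : ∀ x ∈ S, ∀ y ∈ S, x - y ≤ K * d) :
    ∃ c, S ⊆ ⋃ i : Fin (⌊K⌋₊ + 1), Icc (c + i * d) (c + (i + 1) * d) := by
  refine ⟨sInf S, fun x hx => mem_iUnion.2 ?_⟩
  have hbelow : ∀ y ∈ S, x - K * d ≤ y := fun y hy => sub_le_comm.1 (hS x hx y hy)
  have hle : sInf S ≤ x := csInf_le ⟨_, hbelow⟩ hx
  have hge : x - K * d ≤ sInf S := le_csInf ⟨x, hx⟩ hbelow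
  obtain rfl | hd := hd.eq_or_lt
  · exact ⟨0, by simp only [mul_zero, sub_zero] at hge ⊢; simp [hle.antisymm hge]⟩
  · have h0 : 0 ≤ (x - sInf S) / d := div_nonneg (sub_nonneg.2 hle) hd.le
    have hK : (x - sInf S) / d ≤ K := (div_le_iff₀ hd).2 (by linarith)
    have hlow := (le_div_iff₀ hd).1 (Nat.floor_le h0)
    have hupp := (div_lt_iff₀ hd).1 (Nat.lt_floor_add_one ((x - sInf S) / d))
    have hfloor : ⌊(x - sInf S) / d⌋₊ < ⌊K⌋₊ + 1 :=
      (Nat.floor_lt h0).2 (hK.trans_lt (mod_cast Nat.lt_floor_add_one K))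
    exact ⟨⟨_, hfloor⟩, by linarith, by linarith⟩

section Gauge

variable {X : Type*} [MetricSpace X] {A : Set X} {φ : X → ℝ} {K : ℝ≥0}

lemma exists_cover_image_ediam_eq (hφ : LipschitzOnWith K φ A) {κ : Type*} {t : κ → Set X}
    (hA : A ⊆ iUnion t) (ht : ∀ k, Metric.ediam (t k) ≠ ∞) :
    ∃ T : {k // (t k).Nonempty} → Fin (⌊K⌋₊ + 1) → Set ℝ,
      φ '' A ⊆ ⋃ p : {k // (t k).Nonempty} × Fin (⌊K⌋₊ + 1), T p.1 p.2 ∧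
      ∀ k i, Metric.ediam (T k i) = Metric.ediam (t k) := by
  have hlip : ∀ k, ∀ x ∈ φ '' (t k ∩ A), ∀ y ∈ φ '' (t k ∩ A), x - y ≤ K * Metric.diam (t k) := by
    rintro k _ ⟨x, ⟨hx, hxA⟩, rfl⟩ _ ⟨y, ⟨hy, hyA⟩, rfl⟩
    calc φ x - φ y ≤ dist (φ x) (φ y) := le_abs_self _
      _ ≤ K * dist x y := hφ.dist_le_mul x hxA y hyA
      _ ≤ K * Metric.diam (t k) := by
        gcongr
        exact Metric.dist_le_diam_of_mem' (ht k) hx hy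
  choose c hc using fun k => exists_subset_iUnion_Icc Metric.diam_nonneg (hlip k)
  refine ⟨fun k i => Icc (c k + i * Metric.diam (t k)) (c k + (i + 1) * Metric.diam (t k)), ?_,
    fun k i => ?_⟩
  · rintro _ ⟨x, hx, rfl⟩
    obtain ⟨k, hk⟩ := mem_iUnion.1 (hA hx)
    obtain ⟨i, hi⟩ := mem_iUnion.1 (hc k ⟨x, ⟨hk, hx⟩, rfl⟩)
    exact mem_iUnion.2 ⟨⟨⟨k, x, hk⟩, i⟩, hi⟩
  · rw [Real.ediam_Icc, ← ENNReal.ofReal_toReal (ht k), ← Metric.diam]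
    ring_nf

lemma exists_cover_image_tsum_le [MeasurableSpace X] [BorelSpace X] {m : ℝ≥0∞ → ℝ≥0∞}
    (hφ : LipschitzOnWith K φ A) {c r : ℝ≥0∞} (hc : Measure.mkMetric m A < c) (hr0 : 0 < r)
    (hr : r ≠ ∞) :
    ∃ (ι : Type) (_ : Countable ι) (T : ι → Set ℝ), φ '' A ⊆ iUnion T ∧
      (∀ i, Metric.ediam (T i) ≤ r) ∧ ∑' i, m (Metric.ediam (T i)) ≤ (⌊K⌋₊ + 1 : ℕ) * c := by
  obtain ⟨t, hA, htr, htc⟩ := exists_cover_tsum_lt_of_mkMetric_lt hc hr0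
  obtain ⟨T, hT, hTt⟩ :=
    exists_cover_image_ediam_eq hφ hA fun k => ne_top_of_le_ne_top hr (htr k)
  refine ⟨{k // (t k).Nonempty} × Fin (⌊K⌋₊ + 1), inferInstance, fun p => T p.1 p.2, hT,
    fun p => (hTt p.1 p.2).trans_le (htr p.1), ?_⟩
  calc ∑' p : {k // (t k).Nonempty} × Fin (⌊K⌋₊ + 1), m (Metric.ediam (T p.1 p.2))
      = ∑' k : {k // (t k).Nonempty}, ∑' i, m (Metric.ediam (T k i)) :=
        ENNReal.tsum_prod (f := fun k i => m (Metric.ediam (T k i)))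
    _ = ∑' k : {k // (t k).Nonempty},
          (⌊K⌋₊ + 1 : ℕ) * ⨆ _ : (t k).Nonempty, m (Metric.ediam (t k)) :=
        tsum_congr fun k => by simp [hTt, k.2]
    _ = (⌊K⌋₊ + 1 : ℕ) * ∑' k : {k // (t k).Nonempty},
          ⨆ _ : (t k).Nonempty, m (Metric.ediam (t k)) := ENNReal.tsum_mul_left
    _ ≤ (⌊K⌋₊ + 1 : ℕ) * c := by
        gcongr
        exact (ENNReal.tsum_comp_le_tsum_of_injective Subtype.val_injective _).trans htc.le

/-- `m` need not be doubling: the image of a set of diameter `d` is covered by boundedly many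
intervals of the same length `d`. -/
theorem mkMetric_image_le [MeasurableSpace X] [BorelSpace X] (m : ℝ≥0∞ → ℝ≥0∞)
    (hφ : LipschitzOnWith K φ A) :
    Measure.mkMetric m (φ '' A) ≤ (⌊K⌋₊ + 1 : ℕ) * Measure.mkMetric m A := by
  have hN : ((⌊K⌋₊ + 1 : ℕ) : ℝ≥0∞) ≠ 0 := Nat.cast_ne_zero.2 (Nat.succ_ne_zero _)
  have hNtop : ((⌊K⌋₊ + 1 : ℕ) : ℝ≥0∞) ≠ ∞ := ENNReal.natCast_ne_top _
  rw [← ENNReal.div_le_iff' hN hNtop]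
  refine le_of_forall_gt_imp_ge_of_dense fun c hc => (ENNReal.div_le_iff' hN hNtop).2 ?_
  let r : ℕ → ℝ≥0∞ := fun n => ((n + 1 : ℕ) : ℝ≥0∞)⁻¹
  have hr : Tendsto r atTop (𝓝 0) :=
    ENNReal.tendsto_inv_nat_nhds_zero.comp (tendsto_add_atTop_nat 1)
  have hr0 : ∀ n, 0 < r n := fun n => ENNReal.inv_pos.2 (ENNReal.natCast_ne_top _)
  have hrtop : ∀ n, r n ≠ ∞ := fun n => ENNReal.inv_ne_top.2 (Nat.cast_ne_zero.2 n.succ_ne_zero)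
  choose ι hι T hT hTr hsum using fun n => exists_cover_image_tsum_le hφ hc (hr0 n) (hrtop n)
  calc Measure.mkMetric m (φ '' A)
      ≤ liminf (fun n => ∑' i, m (Metric.ediam (T n i))) atTop :=
        Measure.mkMetric_le_liminf_tsum _ r hr T (.of_forall hTr) (.of_forall hT) m
    _ ≤ liminf (fun _ : ℕ => (⌊K⌋₊ + 1 : ℕ) * c) atTop := liminf_le_liminf (.of_forall hsum)
    _ = (⌊K⌋₊ + 1 : ℕ) * c := liminf_const _

end Gauge

instance (g : ℝ≥0 → ℝ≥0) : (gaugeHausdorff g).IsAddLeftInvariant where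
  map_add_left_eq_self c := Measure.ext fun s hs => by
    have hmap := DFunLike.congr_fun (OuterMeasure.isometryEquiv_map_mkMetric
      (fun d : ℝ≥0∞ => (g d.toNNReal : ℝ≥0∞)) (IsometryEquiv.addLeft c)) s
    rw [OuterMeasure.map_apply, OuterMeasure.coe_mkMetric] at hmap
    rwa [Measure.map_apply (measurable_const_add c) hs]

section SigmaFinite

variable {α : Type*} [MeasurableSpace α] {μ : Measure α} {A E : Set α}

lemma exists_iUnion_eq_measure_lt_top (hA : SigmaFinite (μ.restrict A)) :
    ∃ s : ℕ → Set α, (∀ n, μ (s n) < ∞) ∧ ⋃ n, s n = A := by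
  refine ⟨fun n => spanningSets (μ.restrict A) n ∩ A, fun n => ?_, ?_⟩
  · rw [← Measure.restrict_apply (measurableSet_spanningSets _ n)]
    exact measure_spanningSets_lt_top _ n
  · rw [← iUnion_inter, iUnion_spanningSets, univ_inter]

lemma exists_measurable_superset_sigmaFinite {s : ℕ → Set α} (hs : ∀ n, μ (s n) < ∞)
    (hsE : ⋃ n, s n ⊆ E) (hE : MeasurableSet E) :
    ∃ B, MeasurableSet B ∧ ⋃ n, s n ⊆ B ∧ B ⊆ E ∧ SigmaFinite (μ.restrict B) := by
  let B : ℕ → Set α := fun n => toMeasurable μ (s n) ∩ E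
  have hB : MeasurableSet (⋃ n, B n) :=
    .iUnion fun n => (measurableSet_toMeasurable _ _).inter hE
  refine ⟨⋃ n, B n, hB, iUnion_mono fun n => subset_inter (subset_toMeasurable _ _)
    ((subset_iUnion s n).trans hsE), iUnion_subset fun n => inter_subset_right, ?_⟩
  refine Measure.sigmaFinite_of_countable (S := insert (⋃ n, B n)ᶜ (range B))
    ((countable_range B).insert _) ?_ ?_
  · rintro _ (rfl | ⟨n, rfl⟩)
    · rw [Measure.restrict_apply hB.compl, compl_inter_self, measure_empty]
      exact ENNReal.zero_lt_top
    · exact (Measure.restrict_apply_le _ _).trans_lt <| (measure_mono inter_subset_left).trans_lt <|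
        (measure_toMeasurable _).trans_lt (hs n)
  · rw [sUnion_insert, sUnion_range, compl_union_self]

end SigmaFinite

section Transfer

variable {A E F : Set ℝ} {φ ψ : ℝ → ℝ} {K L : ℝ≥0}

lemma MeasuredByHausdorff.exists_measured_superset_image (hA : MeasuredByHausdorff A)
    (hE : MeasurableSet E) (hψ : LipschitzOnWith K ψ A) (hψE : ψ '' A ⊆ E)
    (hφ : LipschitzOnWith L φ (ψ '' A)) (hinv : LeftInvOn φ ψ A) :
    ∃ B ⊆ E, ψ '' A ⊆ B ∧ Measured B := by
  obtain ⟨g, -, hpos, hfin⟩ := hA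
  obtain ⟨s, hs, hsA⟩ := exists_iUnion_eq_measure_lt_top hfin
  have hψs : ∀ n, gaugeHausdorff g (ψ '' s n) < ∞ := fun n =>
    (mkMetric_image_le _ (hψ.mono (hsA ▸ subset_iUnion s n))).trans_lt
      (ENNReal.mul_lt_top (ENNReal.natCast_lt_top _) (hs n))
  have hψA : ⋃ n, ψ '' s n = ψ '' A := by rw [← image_iUnion, hsA]
  obtain ⟨B, hB, hAB, hBE, hBfin⟩ :=
    exists_measurable_superset_sigmaFinite hψs (hψA.trans_subset hψE) hE
  rw [hψA] at hAB
  refine ⟨B, hBE, hAB, hB, gaugeHausdorff g, inferInstance, pos_iff_ne_zero.2 fun h0 => ?_, hBfin⟩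
  have hle : gaugeHausdorff g (φ '' (ψ '' A)) ≤ _ := mkMetric_image_le _ hφ
  rw [hinv.image_image, ← gaugeHausdorff, measure_mono_null hAB h0, mul_zero] at hle
  exact hpos.not_ge hle

lemma IsCountableUnionOf.image {P Q : Set ℝ → Prop} (hF : IsCountableUnionOf P F)
    (h : ∀ A ⊆ F, P A → ∃ B ⊆ ψ '' F, ψ '' A ⊆ B ∧ Q B) : IsCountableUnionOf Q (ψ '' F) := by
  obtain ⟨𝒜, hcount, hP, rfl⟩ := hF
  choose! B hBF hAB hQ using fun A (hA : A ∈ 𝒜) => h A (subset_sUnion_of_mem hA) (hP A hA)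
  refine ⟨B '' 𝒜, hcount.image B, forall_mem_image.2 hQ, ?_⟩
  rw [sUnion_image]
  refine (iUnion₂_subset hBF).antisymm ?_
  rw [image_sUnion, sUnion_image]
  exact iUnion₂_mono hAB

theorem IsCountableUnionOf.measured_image_of_lipschitzOnWith
    (hF : IsCountableUnionOf MeasuredByHausdorff F) (hψF : MeasurableSet (ψ '' F))
    (hψ : LipschitzOnWith K ψ F) (hφ : LipschitzOnWith L φ (ψ '' F)) (hinv : LeftInvOn φ ψ F) :
    IsCountableUnionOf Measured (ψ '' F) :=
  hF.image fun _ hAF hA => hA.exists_measured_superset_image hψF (hψ.mono hAF)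
    (image_mono hAF) (hφ.mono (image_mono hAF)) (hinv.mono hAF)

end Transfer

theorem IsCountableUnionOf.measured_of_img {f : C1Unit} (hf : f.IsBiLipschitz) {E : Set ℝ}
    (hE : MeasurableSet E) (hE1 : E ⊆ Icc 0 1)
    (hfE : IsCountableUnionOf MeasuredByHausdorff (f.img E)) : IsCountableUnionOf Measured E := by
  obtain ⟨K, L, hK, hL⟩ := hf
  let ψ : ℝ → ℝ := fun y => (Function.invFun f.1.1 y : Icc (0 : ℝ) 1)
  have hψf : ∀ x, ψ (f.1.1 x) = x := fun x =>
    congrArg Subtype.val (Function.leftInverse_invFun hL.injective x)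
  have himage : ψ '' f.img E = E := by
    rw [C1Unit.img, image_image]
    simp only [hψf]
    exact Subtype.image_preimage_coe _ _ |>.trans (inter_eq_right.2 hE1)
  have hψ : LipschitzOnWith L ψ (f.img E) := by
    rintro _ ⟨x, -, rfl⟩ _ ⟨y, -, rfl⟩
    rw [hψf, hψf]
    exact hL x y
  have hφ : LipschitzOnWith K (IccExtend zero_le_one f.1.1) E := fun x hx y hy => by
    rw [IccExtend_of_mem _ _ (hE1 hx), IccExtend_of_mem _ _ (hE1 hy)]
    exact hK ⟨x, hE1 hx⟩ ⟨y, hE1 hy⟩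
  have hinv : LeftInvOn (IccExtend zero_le_one f.1.1) ψ (f.img E) := by
    rintro _ ⟨x, -, rfl⟩
    rw [hψf, IccExtend_val]
  rw [← himage] at hE hφ ⊢
  exact hfE.measured_image_of_lipschitzOnWith hE hψ hφ hinv

/-! ### Sums of translates -/

/-- The sum of all translates of `ν`, a translation invariant measure on `ℝ` which is in general not
`σ`-finite. -/
noncomputable def sumTranslates (ν : Measure ℝ) : Measure ℝ :=
  Measure.sum fun t : ℝ => ν.map (· + t)

section SumTranslates

variable {ν : Measure ℝ} {K : Set ℝ}

lemma sumTranslates_apply {s : Set ℝ} (hs : MeasurableSet s) :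
    sumTranslates ν s = ∑' t : ℝ, ν ((· + t) ⁻¹' s) := by
  rw [sumTranslates, Measure.sum_apply _ hs]
  exact tsum_congr fun t => Measure.map_apply (measurable_add_const t) hs

instance : (sumTranslates ν).IsAddLeftInvariant := by
  refine forall_measure_preimage_add_iff _ |>.1 fun c s hs => ?_
  rw [sumTranslates_apply hs, sumTranslates_apply (measurable_const_add c hs),
    ← (Equiv.addLeft c).tsum_eq fun t => ν ((· + t) ⁻¹' s)]
  refine tsum_congr fun t => ?_
  simp only [Equiv.coe_addLeft, ← preimage_comp, Function.comp_def, add_left_comm]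

lemma OnlyTrivialDifferences.subsingleton_inter_preimage_add (hK : OnlyTrivialDifferences K)
    {t : ℝ} (ht : t ≠ 0) : (K ∩ (· + t) ⁻¹' K).Subsingleton := by
  rintro x ⟨hx, hxt⟩ y ⟨hy, hyt⟩
  obtain ⟨-, h⟩ | ⟨h, -⟩ := hK (x + t) hxt x hx (y + t) hyt y hy (by ring)
  · exact h
  · exact absurd (add_eq_left.1 h) ht

lemma OnlyTrivialDifferences.sumTranslates_apply_self [NullSingletonClass ν]
    (hK : OnlyTrivialDifferences K) (hKm : MeasurableSet K) (hν : ν Kᶜ = 0) :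
    sumTranslates ν K = ν K := by
  rw [sumTranslates_apply hKm, tsum_eq_single 0]
  · simp only [add_zero, preimage_id']
  · intro t ht
    refine measure_mono_null (fun x hx => ?_)
      (measure_union_null ((hK.subsingleton_inter_preimage_add ht).measure_zero ν) hν)
    exact (em (x ∈ K)).imp (fun hxK => ⟨hxK, hx⟩) id

end SumTranslates

lemma exists_nullSingletonClass_isProbabilityMeasure_compl_eq_zero {α : Type*} [MeasurableSpace α]
    [StandardBorelSpace α] {K : Set α} (hK : MeasurableSet K) (hunc : ¬ K.Countable) :
    ∃ ν : Measure α, NullSingletonClass ν ∧ IsProbabilityMeasure ν ∧ ν Kᶜ = 0 := by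
  have : StandardBorelSpace K := hK.standardBorel
  let e : K ≃ᵐ ℝ := PolishSpace.measurableEquivOfNotCountable hunc
    (not_countable_iff.2 inferInstance)
  let j : ℝ → α := fun t => e.symm t
  have hj : Measurable j := measurable_subtype_coe.comp e.symm.measurable
  have hjinj : Function.Injective j := Subtype.val_injective.comp e.symm.injective
  have : IsProbabilityMeasure ((volume : Measure ℝ).restrict (Icc 0 1)) := ⟨by simp⟩
  refine ⟨(volume.restrict (Icc 0 1)).map j, ⟨fun x => ?_⟩,
    Measure.isProbabilityMeasure_map hj.aemeasurable, ?_⟩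
  · rw [Measure.map_apply hj (measurableSet_singleton x)]
    exact (subsingleton_singleton.preimage hjinj).measure_zero _
  · rw [Measure.map_apply hj hK.compl,
      eq_empty_of_forall_notMem (s := j ⁻¹' Kᶜ) fun t ht => ht (e.symm t).2, measure_empty]

lemma OnlyTrivialDifferences.measured {K : Set ℝ} (hK : OnlyTrivialDifferences K)
    (hKm : MeasurableSet K) (hunc : ¬ K.Countable) : Measured K := by
  obtain ⟨ν, _, _, hν⟩ := exists_nullSingletonClass_isProbabilityMeasure_compl_eq_zero hKm hunc
  have hνK : sumTranslates ν K = 1 := by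
    rw [hK.sumTranslates_apply_self hKm hν, ← prob_compl_eq_zero_iff hKm, hν]
  have : IsFiniteMeasure ((sumTranslates ν).restrict K) :=
    isFiniteMeasure_restrict.2 (hνK ▸ ENNReal.one_ne_top)
  exact ⟨hKm, sumTranslates ν, inferInstance, hνK ▸ one_pos, inferInstance⟩

lemma isCountableUnionOf_measured_of_countable {E : Set ℝ} (hE : E.Countable) :
    IsCountableUnionOf Measured E := by
  refine ⟨(fun x => {x}) '' E, hE.image _, forall_mem_image.2 fun x _ => ?_, by simp⟩
  have : IsFiniteMeasure ((Measure.count : Measure ℝ).restrict {x}) := ⟨by simp⟩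
  exact ⟨measurableSet_singleton x, Measure.count, inferInstance, by simp, inferInstance⟩

section Image

variable {f : C1Unit} {E : Set ℝ}

lemma C1Unit.isCompact_img (hE : IsCompact E) : IsCompact (f.img E) :=
  (hE.isClosed.preimage continuous_subtype_val).isCompact.image f.1.1.continuous

lemma C1Unit.IsBiLipschitz.not_countable_img (hf : f.IsBiLipschitz) (hE1 : E ⊆ Icc 0 1)
    (hE : ¬ E.Countable) : ¬ (f.img E).Countable := fun himg => hE <| by
  obtain ⟨-, L, -, hL⟩ := hf
  rw [← inter_eq_self_of_subset_right hE1, ← Subtype.image_preimage_coe]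
  exact (countable_of_injective_of_countable_image hL.injective.injOn himg).image _

end Image

theorem theorem4p7 :
    ∃ (K E : Set ℝ) (f : C1Unit),
      (IsCompact K ∧ Measured K ∧ ¬ IsCountableUnionOf MeasuredByHausdorff K) ∧
      (E ⊆ Set.Icc 0 1 ∧ IsCompact E ∧ HasBoxDimension E 0 ∧ ¬ IsCountableUnionOf Measured E) ∧
      (f.IsBiLipschitz ∧ K = f.img E) ∧
      (∀ᶠ h in residual C1Unit, OnlyTrivialDifferences (h.img E)) := by
  have htyp := eventually_residual_onlyTrivialDifferences isCompact_digitSet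
    hasBoxDimension_digitSet (by norm_num)
  obtain ⟨f, hf, hftriv⟩ := exists_isBiLipschitz_of_eventually_residual htyp
  have huncountable : ¬ digitSet.Countable := fun h =>
    not_isCountableUnionOf_measured_digitSet (isCountableUnionOf_measured_of_countable h)
  have hcompact : IsCompact (f.img digitSet) := C1Unit.isCompact_img isCompact_digitSet
  have hmeasured : Measured (f.img digitSet) := hftriv.measured hcompact.measurableSet
    (hf.not_countable_img digitSet_subset_Icc huncountable)
  have hhausdorff : ¬ IsCountableUnionOf MeasuredByHausdorff (f.img digitSet) := fun h =>
    not_isCountableUnionOf_measured_digitSet <|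
      h.measured_of_img hf isCompact_digitSet.measurableSet digitSet_subset_Icc
  exact ⟨f.img digitSet, digitSet, f, ⟨hcompact, hmeasured, hhausdorff⟩,
    ⟨digitSet_subset_Icc, isCompact_digitSet, hasBoxDimension_digitSet,
      not_isCountableUnionOf_measured_digitSet⟩, ⟨hf, rfl⟩, htyp⟩
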